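/- Let $0<q<1$. Write $(a;q)_n=\prod_{k=0}^{n-1}(1-aq^k)$, $(a;q)_\infty=\prod_{k\ge 0}(1-aq^k)$, $(a,b;q)_\infty=(a;q)_\infty(b;q)_\infty$, $[n]_q!=\prod_{k=1}^n\frac{1-q^k}{1-q}$, and let $$\mathbb C_q=\{z\in\mathbb C:(1-q)|z|^2<1\},\qquad \mathcal I_q=\Big]\tfrac{-2}{\sqrt{1-q}},\tfrac{2}{\sqrt{1-q}}\Big[ .$$ Let $H_n(\cdot|q)$ be the continuous $q$-Hermite polynomials: $H_0=1$, $H_1(x|q)=2x$, $2xH_n(x|q)=H_{n+1}(x|q)+(1-q^n)H_{n-1}(x|q)$. Let $\varphi_n(x)=(q;q)_n^{-1/2}H_n\big(\tfrac{x\sqrt{1-q}}2\big|q\big)$. Let $\mathcal H_{q,0}=L^2(\mathcal I_q,\omega_{q,0}(x)\,dx)$, where $\omega_{q,0}(x)\,dx$ is the $q$-Gaussian measure, $$\omega_{q,0}(x)=\frac{\sqrt{1-q}}{\pi}\,\sin\theta\prod_{n=1}^\infty(1-q^n)\,|1-q^ne^{2i\theta}|^2,\qquad x=\tfrac{2}{\sqrt{1-q}}\cos\theta,\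 \theta\in[0,\pi].$$ For $z\in\mathbb C_q$ let $$\vartheta_z(x)=\mathcal N(|z|^2)^{-1/2}\sum_{n\ge0}\frac{\bar z^{\,n}}{\sqrt{[n]_q!}}\varphi_n(x),\qquad \mathcal N(t)=\sum_{n\ge 0}\frac{t^n}{[n]_q!},$$ be the coherent states (case $\alpha=0$), and let $\mathcal B_0^{(q)}[\varphi](z)=\mathcal N(|z|^2)^{1/2}\langle\varphi,\vartheta_z\rangle_{\mathcal H_{q,0}}$, the scalar product being linear in its first argument. Let $\nu_{q,0}$ be the measure on $\mathbb C$ given in polar coordinates $z=re^{i\theta}$ by $$\nu_{q,0}(d^2z)=\frac{d\theta}{2\pi}\,(q;q)_\infty\sum_{n\ge0}\frac{q^n}{(q;q)_n}\,\delta_{q^{n/2}/\sqrt{1-q}}(dr),$$ and let the Arik–Coon space $\mathcal A^2_{q,0}(\mathbb C)$ be the closure in $L^2(\nu_{q,0})$ of the linear span of the monomials $z^n/\sqrt{[n]_q!}$. A function $f:\mathbb C_q\to\mathbb C$ is said to represent $F\in\mathcal A^2_{q,0}(\mathbb C)$ if some sequence of polynomials converges to $F$ in $L^2(\nu_{q,0})$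 and to $f$ pointwise on $\mathbb C_q$. Then: 1. $\vartheta_z\in\mathcal H_{q,0}$ for every $z\in\mathbb C_q$. 2. Every $F\in\mathcal A^2_{q,0}(\mathbb C)$ is represented by exactly one function on $\mathbb C_q$, and distinct elements are represented by distinct functions; so $\mathcal A^2_{q,0}(\mathbb C)$ is a Hilbert space of functions on $\mathbb C_q$. 3. With this identification, $\mathcal B_0^{(q)}$ is a linear isometry of $\mathcal H_{q,0}$ onto $\mathcal A^2_{q,0}(\mathbb C)$. 4. For all $\varphi\in\mathcal H_{q,0}$ and $z\in\mathbb C_q$, $$\mathcal B_0^{(q)}[\varphi](z)=\int_{\mathcal I_q}\frac{1}{(z\sqrt{1-q}\,e^{-i\theta},z\sqrt{1-q}\,e^{i\theta};q)_\infty}\,\varphi(\xi)\,\omega_{q,0}(\xi)\,d\xi,\qquad \xi=\tfrac{2}{\sqrt{1-q}}\cos\theta,\ \theta\in[0,\pi],$$ the integral being absolutely convergent. 5. The kernel is the generating function of the continuous $q$-Hermite polynomials: for all $z\in\mathbb C_q$ and $\theta\in\mathbb R$, $$\frac{1}{(z\sqrt{1-q}\,e^{-i\theta},z\sqrt{1-q}\,e^{i\theta};q)_\infty}=\sum_{n\ge0}\frac{H_n(\cos\theta|q)}{(q;q)_n}\,(z\sqrt{1-q})^n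 .$$ -/

import Mathlib

open MeasureTheory Filter Topology Polynomial

namespace ArikCoon

noncomputable section

/-- The finite `q`-shifted factorial `(a; q)_n = ∏_{k < n} (1 - a q ^ k)`. -/
def qPoch {R : Type*} [CommRing R] (a q : R) (n : ℕ) : R :=
  ∏ k ∈ Finset.range n, (1 - a * q ^ k)

/-- The infinite `q`-shifted factorial `(a; q)_∞ = ∏_{k ≥ 0} (1 - a q ^ k)`. -/
def qPochInf {R : Type*} [CommRing R] [TopologicalSpace R] (a q : R) : R :=
  ∏' k : ℕ, (1 - a * q ^ k)

/-- The `q`-number `[k]_q = (1 - q ^ k) / (1 - q)`. -/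
def qNumber (q : ℝ) (k : ℕ) : ℝ := (1 - q ^ k) / (1 - q)

/-- The `q`-factorial `[n]_q! = [1]_q ⋯ [n]_q`. -/
def qFactorial (q : ℝ) (n : ℕ) : ℝ := ∏ k ∈ Finset.range n, qNumber q (k + 1)

/-- The open disc `ℂ_q = {z : (1 - q) |z|² < 1}`. -/
def disc (q : ℝ) : Set ℂ := {z | (1 - q) * ‖z‖ ^ 2 < 1}

/-- The open interval `I_q = (-2 / √(1 - q), 2 / √(1 - q))`. -/
def interval (q : ℝ) : Set ℝ := Set.Ioo (-2 / √(1 - q)) (2 / √(1 - q))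

/-- The angle `θ ∈ [0, π]` with `x = (2 / √(1 - q)) cos θ`, for `x` in the closure of `I_q`. -/
def angle (q x : ℝ) : ℝ := Real.arccos (x * √(1 - q) / 2)

/-- The `q`-Gaussian density on `I_q`,
`(√(1 - q) / π) sin θ ∏_{n ≥ 1} (1 - q ^ n) |1 - q ^ n e ^ {2 i θ}|²`. -/
def gaussianDensity (q x : ℝ) : ℝ :=
  √(1 - q) / Real.pi * Real.sin (angle q x) *
    ∏' n : ℕ, (1 - q ^ (n + 1)) *
      ‖1 - (q : ℂ) ^ (n + 1) * Complex.exp (2 * Complex.I * (angle q x : ℂ))‖ ^ 2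

/-- The `q`-Gaussian measure, as a measure on `ℝ` carried by `I_q`. -/
def qGaussian (q : ℝ) : Measure ℝ :=
  (volume.restrict (interval q)).withDensity fun x => ENNReal.ofReal (gaussianDensity q x)

/-- The continuous `q`-Hermite polynomials `H_n(x | q)`:
`2 x H_n = H_{n+1} + (1 - q ^ n) H_{n-1}`. -/
def qHermite (q x : ℝ) : ℕ → ℝ
  | 0 => 1
  | 1 => 2 * x
  | n + 2 => 2 * x * qHermite q x (n + 1) - (1 - q ^ (n + 1)) * qHermite q x n

/-- The normalized polynomials `φ_n(x) = (q; q)_n ^ {-1/2} H_n(x √(1 - q) / 2 | q)`. -/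
def basisFun (q : ℝ) (n : ℕ) (x : ℝ) : ℝ :=
  (√(qPoch q q n))⁻¹ * qHermite q (x * √(1 - q) / 2) n

/-- The normalization function `N(t) = ∑ t ^ n / [n]_q!`. -/
def normalization (q t : ℝ) : ℝ := ∑' n : ℕ, t ^ n / qFactorial q n

/-- The wave function of the coherent state labelled by `z`:
`ϑ_z(x) = N(|z|²) ^ {-1/2} ∑ conj(z) ^ n / √([n]_q!) φ_n(x)`. -/
def coherentState (q : ℝ) (z : ℂ) (x : ℝ) : ℂ :=
  ((√(normalization q (‖z‖ ^ 2)))⁻¹ : ℝ) *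
    ∑' n : ℕ, (starRingEnd ℂ z) ^ n / (√(qFactorial q n) : ℝ) * (basisFun q n x : ℂ)

/-- The coherent state transform `B[φ](z) = N(|z|²) ^ {1/2} ⟨φ, ϑ_z⟩`, `z ∈ ℂ_q`, the scalar
product of `L²(I_q, q-Gaussian)` being linear in its first argument. -/
def bargmannTransform (q : ℝ) (φ : Lp ℂ 2 (qGaussian q)) (z : disc q) : ℂ :=
  (√(normalization q (‖(z : ℂ)‖ ^ 2)) : ℝ) *
    ∫ x, φ x * starRingEnd ℂ (coherentState q z x) ∂(qGaussian q)

/-- The normalized arc length measure on the circle of radius `r` about `0`. -/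
def circleMeasure (r : ℝ) : Measure ℂ :=
  ENNReal.ofReal (1 / (2 * Real.pi)) •
    (volume.restrict (Set.Ico (0 : ℝ) (2 * Real.pi))).map
      fun θ : ℝ => (r : ℂ) * Complex.exp (Complex.I * (θ : ℂ))

/-- The measure `ν(d²z) = (dθ / 2π) (q; q)_∞ ∑_n q ^ n / (q; q)_n δ_{q ^ {n/2} / √(1 - q)}(dr)`,
`z = r e ^ {i θ}`. -/
def arikCoonMeasure (q : ℝ) : Measure ℂ :=
  Measure.sum fun n : ℕ =>
    ENNReal.ofReal (qPochInf q q * (q ^ n / qPoch q q n)) •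
      circleMeasure (√(q ^ n) / √(1 - q))

/-- The Arik–Coon space: the closure in `L²(ν)` of the linear span of the (classes of the)
monomials `z ^ n / √([n]_q!)`. -/
def arikCoonSpace (q : ℝ) : Submodule ℂ (Lp ℂ 2 (arikCoonMeasure q)) :=
  (Submodule.span ℂ {F : Lp ℂ 2 (arikCoonMeasure q) |
    ∃ n : ℕ, F =ᵐ[arikCoonMeasure q]
      fun w : ℂ => w ^ n / ((√(qFactorial q n) : ℝ) : ℂ)}).topologicalClosure

/-- The function `f` on `ℂ_q` is the function given by `F`, an element of the closure of the
polynomials in `L²(ν)`: some sequence of polynomials converges to `F` in `L²(ν)` and to `f` at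
every point of `ℂ_q`. -/
def HasValues (q : ℝ) (F : Lp ℂ 2 (arikCoonMeasure q)) (f : disc q → ℂ) : Prop :=
  ∃ p : ℕ → ℂ[X],
    Tendsto (fun k => eLpNorm (fun w : ℂ => F w - (p k).eval w) 2 (arikCoonMeasure q))
      atTop (𝓝 0) ∧
    ∀ z : disc q, Tendsto (fun k => (p k).eval (z : ℂ)) atTop (𝓝 (f z))

/-- `1 / (z √(1 - q) e ^ {-i θ}, z √(1 - q) e ^ {i θ}; q)_∞`. -/
def kernelAngle (q : ℝ) (z : ℂ) (θ : ℝ) : ℂ :=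
  1 / (qPochInf (z * (√(1 - q) : ℝ) * Complex.exp (-(Complex.I * (θ : ℂ)))) (q : ℂ) *
    qPochInf (z * (√(1 - q) : ℝ) * Complex.exp (Complex.I * (θ : ℂ))) (q : ℂ))

end

end ArikCoon

open ArikCoon

namespace ArikCoon

/-! ### q-series: Euler's expansion and the q-Hermite generating function -/

section qSeries

/-! ### `q`-shifted factorials -/

/-! The transform is unitary because it carries one orthonormal basis to another. With `φ_n` the
normalized q-Hermite polynomials and `e_n = z ^ n / √[n]_q!`, the kernel is `∑ e_n(z) φ_n(x)`, so
the transform of `φ` at `z` is `∑ e_n(z) ⟨φ, φ_n⟩`: the value at `z` of the element of the Arik–Coon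
space with the same coordinates as `φ`. Four facts are needed.

The closed form of the kernel: Euler's `∑ t ^ n / (q; q)_n = 1 / (t; q)_∞` at `t e ^ {-iθ}` and `t e
^ {iθ}`, multiplied together, gives the generating function (`hasSum_qHermite`). It also bounds
`|H_n(cos θ | q) / (q; q)_n|` by a multiple of `n + 1`, which justifies every interchange of sum and
integral.

The `φ_n` form a Hilbert basis: after `x = 2 cos θ / √(1 - q)` the density becomes `|(e ^ {2iθ};
q)_∞|²`, which is `1 - e ^ {-2iθ}` times a theta function. The Fourier coefficients of the latter
come from the Jacobi triple product (`integral_theta_even`); moments of `H_n` against it follow in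
closed form (`thetaMean_even`), and orthogonality from them. Completeness is Weierstrass
approximation on a bounded interval.

The `e_n` are orthonormal: angular integration kills the mixed moments, and the radial moments are
Euler's sum at `t = q ^ {n + 1}` (`hasSum_moment`).

Evaluation at `z ∈ ℂ_q` is continuous on polynomials: it is the scalar product with `evalVec`, whose
coefficients are absolutely summable. Hence limits of polynomials have determined values, and these
are power series whose coefficients determine the element (`eq_zero_of_inner_evalVec`). -/

theorem qPoch_zero {R : Type*} [CommRing R] (a q : R) : qPoch a q 0 = 1 := by simp [qPoch]

theorem qPoch_succ {R : Type*} [CommRing R] (a q : R) (n : ℕ) :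
    qPoch a q (n + 1) = qPoch a q n * (1 - a * q ^ n) := by
  simp [qPoch, Finset.prod_range_succ]

theorem summable_norm_mul_pow {𝕜 : Type*} [RCLike 𝕜] (a : 𝕜) {q : 𝕜} (hq : ‖q‖ < 1) :
    Summable fun k : ℕ => ‖-(a * q ^ k)‖ := by
  simpa [norm_mul, norm_pow] using
    (summable_geometric_of_lt_one (norm_nonneg q) hq).mul_left ‖a‖

theorem hasProd_qPochInf {𝕜 : Type*} [RCLike 𝕜] (a : 𝕜) {q : 𝕜} (hq : ‖q‖ < 1) :
    HasProd (fun k : ℕ => 1 - a * q ^ k) (qPochInf a q) := by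
  have := (multipliable_one_add_of_summable (summable_norm_mul_pow a hq)).hasProd
  simp only [← sub_eq_add_neg] at this
  exact this

theorem tendsto_qPoch {𝕜 : Type*} [RCLike 𝕜] (a : 𝕜) {q : 𝕜} (hq : ‖q‖ < 1) :
    Tendsto (qPoch a q) atTop (𝓝 (qPochInf a q)) :=
  (hasProd_qPochInf a hq).tendsto_prod_nat

theorem qPochInf_ne_zero {𝕜 : Type*} [RCLike 𝕜] {a q : 𝕜} (ha : ‖a‖ < 1) (hq : ‖q‖ < 1) :
    qPochInf a q ≠ 0 := by
  have h : ∀ k : ℕ, 1 + -(a * q ^ k) ≠ 0 := fun k h0 => by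
    have h1 : a * q ^ k = 1 := by linear_combination -h0
    have h2 : ‖a * q ^ k‖ < 1 := by
      rw [norm_mul, norm_pow]
      exact lt_of_le_of_lt (mul_le_of_le_one_right (norm_nonneg _)
        (pow_le_one₀ (norm_nonneg _) hq.le)) ha
    rw [h1, norm_one] at h2
    exact lt_irrefl _ h2
  have := tprod_one_add_ne_zero_of_summable h (summable_norm_mul_pow a hq)
  simp only [← sub_eq_add_neg] at this
  exact this

variable {q : ℝ}

theorem norm_lt_one_of_mem (hq0 : 0 < q) (hq1 : q < 1) : ‖q‖ < 1 := by
  rwa [Real.norm_eq_abs, abs_of_pos hq0]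

theorem norm_ofReal_lt_one (hq0 : 0 < q) (hq1 : q < 1) : ‖(q : ℂ)‖ < 1 := by
  rwa [Complex.norm_real, Real.norm_eq_abs, abs_of_pos hq0]

theorem one_sub_pow_succ_pos (hq0 : 0 < q) (hq1 : q < 1) (n : ℕ) : 0 < 1 - q ^ (n + 1) :=
  sub_pos.2 (pow_lt_one₀ hq0.le hq1 n.succ_ne_zero)

theorem qPoch_self_succ (q : ℝ) (n : ℕ) :
    qPoch q q (n + 1) = qPoch q q n * (1 - q ^ (n + 1)) := by
  rw [qPoch_succ, pow_succ']

theorem qPoch_self_pos (hq0 : 0 < q) (hq1 : q < 1) (n : ℕ) : 0 < qPoch q q n := by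
  induction n with
  | zero => simp [qPoch_zero]
  | succ n ih => rw [qPoch_self_succ]; exact mul_pos ih (one_sub_pow_succ_pos hq0 hq1 n)

theorem qPoch_self_antitone (hq0 : 0 < q) (hq1 : q < 1) : Antitone (qPoch q q) :=
  antitone_nat_of_succ_le fun n => by
    rw [qPoch_self_succ]
    exact mul_le_of_le_one_right (qPoch_self_pos hq0 hq1 n).le
      (sub_le_self _ (pow_nonneg hq0.le _))

theorem qPochInf_self_le (hq0 : 0 < q) (hq1 : q < 1) (n : ℕ) : qPochInf q q ≤ qPoch q q n :=
  (qPoch_self_antitone hq0 hq1).le_of_tendsto (tendsto_qPoch q (norm_lt_one_of_mem hq0 hq1)) n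

theorem qPochInf_self_pos (hq0 : 0 < q) (hq1 : q < 1) : 0 < qPochInf q q := by
  have hq := norm_lt_one_of_mem hq0 hq1
  refine lt_of_le_of_ne ?_ (qPochInf_ne_zero hq hq).symm
  exact ge_of_tendsto' (tendsto_qPoch q hq) fun n => (qPoch_self_pos hq0 hq1 n).le

theorem inv_qPoch_self_le (hq0 : 0 < q) (hq1 : q < 1) (n : ℕ) :
    (qPoch q q n)⁻¹ ≤ (qPochInf q q)⁻¹ :=
  inv_anti₀ (qPochInf_self_pos hq0 hq1) (qPochInf_self_le hq0 hq1 n)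

/-! ### Euler's expansion of `1 / (t; q)_∞` -/

theorem summable_norm_euler (hq0 : 0 < q) (hq1 : q < 1) {t : ℂ} (ht : ‖t‖ < 1) :
    Summable fun n : ℕ => ‖t ^ n / ((qPoch q q n : ℝ) : ℂ)‖ := by
  refine Summable.of_nonneg_of_le (fun _ => norm_nonneg _) (fun n => ?_)
    ((summable_geometric_of_lt_one (norm_nonneg t) ht).mul_right (qPochInf q q)⁻¹)
  rw [norm_div, norm_pow, Complex.norm_real, Real.norm_eq_abs,
    abs_of_pos (qPoch_self_pos hq0 hq1 n), div_eq_mul_inv]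
  exact mul_le_mul_of_nonneg_left (inv_qPoch_self_le hq0 hq1 n) (by positivity)

/-- Termwise, `(t ^ n - (tq) ^ n) / (q; q)_n = t · t ^ (n - 1) / (q; q)_{n - 1}` for `n ≥ 1`. -/
theorem tsum_euler_step (hq0 : 0 < q) (hq1 : q < 1) {t : ℂ} (ht : ‖t‖ < 1) :
    (1 - t) * ∑' n : ℕ, t ^ n / ((qPoch q q n : ℝ) : ℂ) =
      ∑' n : ℕ, (t * q) ^ n / ((qPoch q q n : ℝ) : ℂ) := by
  have hs := (summable_norm_euler hq0 hq1 ht).of_norm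
  have htq : ‖t * q‖ < 1 := by
    rw [norm_mul]
    exact lt_of_le_of_lt (mul_le_of_le_one_right (norm_nonneg _)
      (norm_ofReal_lt_one hq0 hq1).le) ht
  have hs' := (summable_norm_euler hq0 hq1 htq).of_norm
  rw [sub_mul, one_mul, sub_eq_iff_eq_add, ← sub_eq_iff_eq_add', ← hs.tsum_sub hs',
    (hs.sub hs').tsum_eq_zero_add, ← tsum_mul_left]
  simp only [pow_zero, sub_self, zero_add]
  refine tsum_congr fun n => ?_
  have h1 : ((qPoch q q n : ℝ) : ℂ) ≠ 0 := by exact_mod_cast (qPoch_self_pos hq0 hq1 n).ne'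
  have h2 : (1 : ℂ) - q ^ (n + 1) ≠ 0 := by
    exact_mod_cast (one_sub_pow_succ_pos hq0 hq1 n).ne'
  rw [qPoch_self_succ]
  push_cast
  field_simp
  ring

theorem qPoch_mul_tsum_euler (hq0 : 0 < q) (hq1 : q < 1) {t : ℂ} (ht : ‖t‖ < 1) (m : ℕ) :
    qPoch t (q : ℂ) m * ∑' n : ℕ, t ^ n / ((qPoch q q n : ℝ) : ℂ) =
      ∑' n : ℕ, (t * q ^ m) ^ n / ((qPoch q q n : ℝ) : ℂ) := by
  induction m with
  | zero => simp [qPoch_zero]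
  | succ m ih =>
    have htm : ‖t * (q : ℂ) ^ m‖ < 1 := by
      rw [norm_mul, norm_pow]
      exact lt_of_le_of_lt (mul_le_of_le_one_right (norm_nonneg _)
        (pow_le_one₀ (norm_nonneg _) (norm_ofReal_lt_one hq0 hq1).le)) ht
    rw [qPoch_succ, mul_right_comm, ih, mul_comm, tsum_euler_step hq0 hq1 htm]
    simp only [mul_assoc, pow_succ]

/-- Iterating the functional equation `m` times moves the argument to `t q ^ m`. As `m → ∞` only the
constant term survives, the series at `t` being the dominating one. -/
theorem hasSum_euler (hq0 : 0 < q) (hq1 : q < 1) {t : ℂ} (ht : ‖t‖ < 1) :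
    HasSum (fun n : ℕ => t ^ n / ((qPoch q q n : ℝ) : ℂ)) (qPochInf t (q : ℂ))⁻¹ := by
  have hq := norm_ofReal_lt_one hq0 hq1
  have hs := summable_norm_euler hq0 hq1 ht
  have h1 : Tendsto (fun m : ℕ => ∑' n : ℕ, (t * (q : ℂ) ^ m) ^ n / ((qPoch q q n : ℝ) : ℂ)) atTop
      (𝓝 (∑' n : ℕ, if n = 0 then 1 else 0)) := by
    refine tendsto_tsum_of_dominated_convergence hs (fun n => ?_) (.of_forall fun m n => ?_)
    · have h0 : Tendsto (fun m : ℕ => t * (q : ℂ) ^ m) atTop (𝓝 0) := by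
        simpa using (tendsto_pow_atTop_nhds_zero_of_norm_lt_one hq).const_mul t
      have := (h0.pow n).div_const ((qPoch q q n : ℝ) : ℂ)
      rcases n with _ | n
      · simp [qPoch_zero]
      · simpa using this
    · rw [norm_div, norm_div]
      refine div_le_div_of_nonneg_right ?_ (norm_nonneg _)
      rw [norm_pow, norm_pow, norm_mul, norm_pow]
      exact pow_le_pow_left₀ (by positivity)
        (mul_le_of_le_one_right (norm_nonneg _) (pow_le_one₀ (norm_nonneg _) hq.le)) n
  simp only [tsum_ite_eq, ← qPoch_mul_tsum_euler hq0 hq1 ht] at h1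
  have h2 := (tendsto_qPoch t hq).mul_const (∑' n : ℕ, t ^ n / ((qPoch q q n : ℝ) : ℂ))
  have h3 := tendsto_nhds_unique h2 h1
  rw [← eq_inv_of_mul_eq_one_right h3]
  exact hs.of_norm.hasSum

/-! ### The generating function of the continuous `q`-Hermite polynomials -/

theorem qHermite_add_two (q x : ℝ) (n : ℕ) :
    qHermite q x (n + 2) = 2 * x * qHermite q x (n + 1) - (1 - q ^ (n + 1)) * qHermite q x n :=
  rfl

/-- The power series of `1 / (a X; q)_∞`. -/
noncomputable def eulerSeries (q : ℝ) (a : ℂ) : PowerSeries ℂ :=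
  PowerSeries.mk fun n => a ^ n / ((qPoch q q n : ℝ) : ℂ)

theorem eulerSeries_rescale (hq0 : 0 < q) (hq1 : q < 1) (a : ℂ) :
    PowerSeries.rescale (q : ℂ) (eulerSeries q a) =
      (1 - PowerSeries.C a * PowerSeries.X) * eulerSeries q a := by
  ext n
  rw [PowerSeries.coeff_rescale, sub_mul, one_mul, map_sub, mul_assoc, PowerSeries.coeff_C_mul]
  rcases n with _ | n
  · simp [eulerSeries]
  · rw [PowerSeries.coeff_succ_X_mul]
    simp only [eulerSeries, PowerSeries.coeff_mk]
    have h1 : ((qPoch q q n : ℝ) : ℂ) ≠ 0 := by exact_mod_cast (qPoch_self_pos hq0 hq1 n).ne'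
    have h2 : (1 : ℂ) - q ^ (n + 1) ≠ 0 := by
      exact_mod_cast (one_sub_pow_succ_pos hq0 hq1 n).ne'
    rw [qPoch_self_succ]
    push_cast
    field_simp
    ring

/-- The product `P` satisfies `P(qX) = (1 - aX)(1 - bX) P(X) = (1 - 2xX + X²) P(X)`. Comparing
coefficients gives the q-Hermite recurrence divided by q-shifted factorials. Working with formal
series avoids any convergence question. -/
theorem coeff_eulerSeries_mul (hq0 : 0 < q) (hq1 : q < 1) {a b : ℂ} (hab : a * b = 1) {x : ℝ}
    (hx : a + b = 2 * x) (n : ℕ) :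
    PowerSeries.coeff n (eulerSeries q a * eulerSeries q b) =
      ((qHermite q x n / qPoch q q n : ℝ) : ℂ) := by
  set P := eulerSeries q a * eulerSeries q b with hP
  have key : PowerSeries.rescale (q : ℂ) P =
      P - PowerSeries.C (2 * x : ℂ) * (PowerSeries.X * P) +
        PowerSeries.X * (PowerSeries.X * P) := by
    rw [hP, map_mul, eulerSeries_rescale hq0 hq1, eulerSeries_rescale hq0 hq1, ← hx, map_add]
    have : PowerSeries.C a * PowerSeries.C b = (1 : PowerSeries ℂ) := by
      rw [← map_mul, hab, map_one]
    linear_combination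
      (PowerSeries.X * PowerSeries.X * eulerSeries q a * eulerSeries q b) * this
  have hne : ∀ n, ((qPoch q q n : ℝ) : ℂ) ≠ 0 := fun n => by
    exact_mod_cast (qPoch_self_pos hq0 hq1 n).ne'
  have hne' : ∀ n : ℕ, (1 : ℂ) - q ^ (n + 1) ≠ 0 := fun n => by
    exact_mod_cast (one_sub_pow_succ_pos hq0 hq1 n).ne'
  have h0 : PowerSeries.coeff 0 P = 1 := by
    simp [hP, PowerSeries.coeff_mul, eulerSeries, qPoch_zero]
  have h1 : PowerSeries.coeff 1 P * (1 - q) = 2 * x := by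
    have := congrArg (PowerSeries.coeff 1) key
    have e1 := PowerSeries.coeff_succ_X_mul 0 P
    have e2 := PowerSeries.coeff_succ_X_mul 0 (PowerSeries.X * P)
    rw [zero_add] at e1 e2
    rw [PowerSeries.coeff_rescale, map_add, map_sub, PowerSeries.coeff_C_mul, e1, e2, h0,
      PowerSeries.coeff_zero_X_mul] at this
    linear_combination -this
  have h2 : ∀ n, PowerSeries.coeff (n + 2) P * (1 - q ^ (n + 2)) =
      2 * x * PowerSeries.coeff (n + 1) P - PowerSeries.coeff n P := fun n => by
    have := congrArg (PowerSeries.coeff (n + 2)) key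
    rw [PowerSeries.coeff_rescale, map_add, map_sub, PowerSeries.coeff_C_mul,
      PowerSeries.coeff_succ_X_mul, PowerSeries.coeff_succ_X_mul,
      PowerSeries.coeff_succ_X_mul] at this
    linear_combination -this
  induction n using Nat.twoStepInduction with
  | zero => simp [h0, qHermite, qPoch_zero]
  | one =>
    have := hne' 0
    rw [zero_add, pow_one] at this
    rw [← mul_left_inj' this, h1]
    simp [qHermite, qPoch]
    field_simp
  | more n ih1 ih2 =>
    rw [← mul_left_inj' (hne' (n + 1)), show n + 1 + 1 = n + 2 from rfl, h2, ih1, ih2,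
      qHermite_add_two, qPoch_self_succ q (n + 1), qPoch_self_succ q n]
    have e1 := hne n
    have e2 := hne' n
    have e3 := hne' (n + 1)
    push_cast
    field_simp

/-- The coefficient is a sum of `n + 1` products, each factor being at most `1 / (q; q)_∞` in
modulus. -/
theorem norm_coeff_eulerSeries_mul_le (hq0 : 0 < q) (hq1 : q < 1) {a b : ℂ} (ha : ‖a‖ = 1)
    (hb : ‖b‖ = 1) (n : ℕ) :
    ‖PowerSeries.coeff n (eulerSeries q a * eulerSeries q b)‖ ≤
      (n + 1) * ((qPochInf q q)⁻¹) ^ 2 := by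
  have hc : ∀ (c : ℂ) (k : ℕ), ‖c‖ = 1 →
      ‖PowerSeries.coeff k (eulerSeries q c)‖ ≤ (qPochInf q q)⁻¹ := fun c k h => by
    rw [eulerSeries, PowerSeries.coeff_mk, norm_div, norm_pow, h, one_pow, Complex.norm_real,
      Real.norm_eq_abs, abs_of_pos (qPoch_self_pos hq0 hq1 k), one_div]
    exact inv_qPoch_self_le hq0 hq1 k
  rw [PowerSeries.coeff_mul]
  refine (norm_sum_le_of_le (n := fun _ => ((qPochInf q q)⁻¹) ^ 2) _ fun p _ => ?_).trans ?_
  · rw [norm_mul, sq]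
    exact mul_le_mul (hc a _ ha) (hc b _ hb) (norm_nonneg _)
      (inv_nonneg.2 (qPochInf_self_pos hq0 hq1).le)
  · simp

theorem norm_exp_I_mul (θ : ℝ) : ‖Complex.exp (Complex.I * θ)‖ = 1 := by
  rw [mul_comm]; exact Complex.norm_exp_ofReal_mul_I θ

theorem norm_exp_neg_I_mul (θ : ℝ) : ‖Complex.exp (-(Complex.I * θ))‖ = 1 := by
  rw [Complex.exp_neg, norm_inv, norm_exp_I_mul, inv_one]

theorem exp_neg_mul_exp (θ : ℝ) :
    Complex.exp (-(Complex.I * θ)) * Complex.exp (Complex.I * θ) = 1 := by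
  rw [← Complex.exp_add]; simp

theorem exp_neg_add_exp (θ : ℝ) :
    Complex.exp (-(Complex.I * θ)) + Complex.exp (Complex.I * θ) = 2 * (Real.cos θ : ℝ) := by
  rw [Complex.ofReal_cos, Complex.two_cos, add_comm]
  ring_nf

theorem abs_qHermite_cos_div_le (hq0 : 0 < q) (hq1 : q < 1) (θ : ℝ) (n : ℕ) :
    |qHermite q (Real.cos θ) n / qPoch q q n| ≤ (n + 1) * ((qPochInf q q)⁻¹) ^ 2 := by
  have := norm_coeff_eulerSeries_mul_le hq0 hq1 (norm_exp_neg_I_mul θ) (norm_exp_I_mul θ) n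
  rwa [coeff_eulerSeries_mul hq0 hq1 (exp_neg_mul_exp θ) (exp_neg_add_exp θ),
    Complex.norm_real, Real.norm_eq_abs] at this

theorem hasSum_qHermite (hq0 : 0 < q) (hq1 : q < 1) {t : ℂ} (ht : ‖t‖ < 1) (θ : ℝ) :
    HasSum (fun n : ℕ => ((qHermite q (Real.cos θ) n / qPoch q q n : ℝ) : ℂ) * t ^ n)
      (1 / (qPochInf (t * Complex.exp (-(Complex.I * θ))) (q : ℂ) *
        qPochInf (t * Complex.exp (Complex.I * θ)) (q : ℂ))) := by
  set a := Complex.exp (-(Complex.I * θ))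
  set b := Complex.exp (Complex.I * θ)
  have ha : ‖t * a‖ < 1 := by rwa [norm_mul, norm_exp_neg_I_mul, mul_one]
  have hb : ‖t * b‖ < 1 := by rwa [norm_mul, norm_exp_I_mul, mul_one]
  have h := hasSum_sum_range_mul_of_summable_norm (summable_norm_euler hq0 hq1 ha)
    (summable_norm_euler hq0 hq1 hb)
  rw [(hasSum_euler hq0 hq1 ha).tsum_eq, (hasSum_euler hq0 hq1 hb).tsum_eq] at h
  rw [one_div, mul_inv]
  convert! h using 2 with n
  rw [← coeff_eulerSeries_mul hq0 hq1 (exp_neg_mul_exp θ) (exp_neg_add_exp θ),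
    PowerSeries.coeff_mul, Finset.Nat.sum_antidiagonal_eq_sum_range_succ_mk, Finset.sum_mul]
  refine Finset.sum_congr rfl fun k hk => ?_
  simp only [eulerSeries, PowerSeries.coeff_mk]
  have : t ^ n = t ^ k * t ^ (n - k) := by
    rw [← pow_add, Nat.add_sub_cancel' (Nat.lt_succ_iff.1 (Finset.mem_range.1 hk))]
  rw [this, mul_pow, mul_pow]
  ring

end qSeries


/-! ### The Jacobi triple product, through its finite form -/

section tripleProduct

variable {q : ℝ}

/-! ### The Fourier coefficients of the theta function -/

/-- `e ^ {iθ}`. -/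
noncomputable def circ (θ : ℝ) : ℂ := Complex.exp (Complex.I * θ)

theorem norm_circ (θ : ℝ) : ‖circ θ‖ = 1 := norm_exp_I_mul θ

theorem circ_ne_zero (θ : ℝ) : circ θ ≠ 0 := Complex.exp_ne_zero _

theorem circ_inv (θ : ℝ) : (circ θ)⁻¹ = Complex.exp (-(Complex.I * θ)) :=
  (Complex.exp_neg _).symm

theorem circ_add_inv (θ : ℝ) : circ θ + (circ θ)⁻¹ = 2 * (Real.cos θ : ℝ) := by
  rw [circ_inv, add_comm]; exact exp_neg_add_exp θ

theorem continuous_circ : Continuous circ := by unfold circ; fun_prop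

theorem continuous_circ_zpow (j : ℤ) : Continuous fun θ => circ θ ^ j :=
  continuous_circ.zpow₀ j fun θ => Or.inl (circ_ne_zero θ)

theorem integral_circ_zpow (j : ℤ) :
    ∫ θ in (-Real.pi)..Real.pi, circ θ ^ j = if j = 0 then 2 * (Real.pi : ℂ) else 0 := by
  split_ifs with hj
  · subst hj; simp; ring
  · have h : ∀ θ : ℝ, circ θ ^ j = Complex.exp ((Complex.I * j) * θ) := fun θ => by
      rw [circ, ← Complex.exp_int_mul]; congr 1; ring
    have hc : Complex.I * (j : ℂ) ≠ 0 := mul_ne_zero Complex.I_ne_zero (by exact_mod_cast hj)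
    simp only [h]
    rw [integral_exp_mul_complex hc, div_eq_zero_iff]
    left
    rw [sub_eq_zero, Complex.exp_eq_exp_iff_exists_int]
    exact ⟨j, by push_cast; ring⟩

/-- The product `(x; q)_N (q / x; q)_N` at `x = e ^ {2iθ}`. -/
noncomputable def thetaFin (q : ℝ) (N : ℕ) (θ : ℝ) : ℂ :=
  qPoch (circ θ ^ 2) (q : ℂ) N * qPoch (q * (circ θ ^ 2)⁻¹) (q : ℂ) N

/-- The theta function `(x; q)_∞ (q / x; q)_∞` at `x = e ^ {2iθ}`. -/
noncomputable def theta (q : ℝ) (θ : ℝ) : ℂ :=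
  qPochInf (circ θ ^ 2) (q : ℂ) * qPochInf (q * (circ θ ^ 2)⁻¹) (q : ℂ)

theorem continuous_thetaFin (q : ℝ) (N : ℕ) : Continuous (thetaFin q N) := by
  unfold thetaFin qPoch
  have := continuous_circ
  have h2 : Continuous fun θ => (circ θ ^ 2)⁻¹ :=
    (continuous_circ.pow 2).inv₀ fun θ => pow_ne_zero 2 (circ_ne_zero θ)
  fun_prop

/-- With `x = e ^ {2iθ}`, the new factor is `(1 - x q ^ N)(1 - q ^ {N + 1} / x) = 1 + q ^ {2N + 1} -
q ^ N x - q ^ {N + 1} / x`, and multiplying by `x` shifts the exponent `j` by `2`. -/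
theorem thetaFin_succ (q : ℝ) (N : ℕ) (θ : ℝ) (j : ℤ) :
    circ θ ^ j * thetaFin q (N + 1) θ =
      (1 + q ^ (2 * N + 1)) * (circ θ ^ j * thetaFin q N θ) -
        q ^ N * (circ θ ^ (j + 2) * thetaFin q N θ) -
          q ^ (N + 1) * (circ θ ^ (j - 2) * thetaFin q N θ) := by
  have h := circ_ne_zero θ
  rw [thetaFin, qPoch_succ, qPoch_succ, thetaFin, zpow_add₀ h, zpow_sub₀ h]
  norm_cast
  push_cast
  field_simp
  ring

theorem integral_thetaFin_succ (q : ℝ) (N : ℕ) (j : ℤ) :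
    ∫ θ in (-Real.pi)..Real.pi, circ θ ^ j * thetaFin q (N + 1) θ =
      (1 + q ^ (2 * N + 1)) * (∫ θ in (-Real.pi)..Real.pi, circ θ ^ j * thetaFin q N θ) -
        q ^ N * (∫ θ in (-Real.pi)..Real.pi, circ θ ^ (j + 2) * thetaFin q N θ) -
          q ^ (N + 1) * (∫ θ in (-Real.pi)..Real.pi, circ θ ^ (j - 2) * thetaFin q N θ) := by
  have hi : ∀ (c : ℂ) (j : ℤ), IntervalIntegrable
      (fun θ => c * (circ θ ^ j * thetaFin q N θ)) volume (-Real.pi) Real.pi := fun c j =>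
    (continuous_const.mul
      ((continuous_circ_zpow j).mul (continuous_thetaFin q N))).intervalIntegrable _ _
  simp only [thetaFin_succ]
  rw [intervalIntegral.integral_sub ((hi _ _).sub (hi _ _)) (hi _ _),
    intervalIntegral.integral_sub (hi _ _) (hi _ _), intervalIntegral.integral_const_mul,
    intervalIntegral.integral_const_mul, intervalIntegral.integral_const_mul]

/-- `1 / (q; q)_k`, extended by `0` to negative `k`. -/
noncomputable def invQPoch (q : ℝ) : ℤ → ℝ
  | Int.ofNat n => (qPoch q q n)⁻¹
  | Int.negSucc _ => 0

/-- The extension by zero makes this recurrence valid on all of `ℤ`; at `k = 0` the factor `1 - q ^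
0` vanishes. No case split on the range of `k` is then needed in the finite triple product. -/
theorem invQPoch_sub_one (hq0 : 0 < q) (hq1 : q < 1) (k : ℤ) :
    invQPoch q (k - 1) = (1 - q ^ k) * invQPoch q k := by
  rcases k with (_ | n) | n
  · have : (Int.ofNat 0 - 1 : ℤ) = Int.negSucc 0 := rfl
    rw [this]
    simp [invQPoch]
  · have : (Int.ofNat (n + 1) - 1 : ℤ) = Int.ofNat n := by simp
    rw [this]
    have h1 := (qPoch_self_pos hq0 hq1 n).ne'
    have h2 := (one_sub_pow_succ_pos hq0 hq1 n).ne'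
    simp only [invQPoch, qPoch_self_succ, Int.ofNat_eq_natCast, zpow_natCast]
    field_simp
  · have : (Int.negSucc n - 1 : ℤ) = Int.negSucc (n + 1) := by
      rw [Int.negSucc_eq, Int.negSucc_eq]; push_cast; ring
    rw [this]
    simp [invQPoch]

theorem tendsto_invQPoch (hq0 : 0 < q) (hq1 : q < 1) (k : ℤ) :
    Tendsto (fun N : ℕ => invQPoch q (N + k)) atTop (𝓝 (qPochInf q q)⁻¹) := by
  have h := ((tendsto_qPoch q (norm_lt_one_of_mem hq0 hq1)).inv₀
    (qPochInf_self_pos hq0 hq1).ne')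
  have h2 : Tendsto (fun N : ℕ => ((N : ℤ) + k).toNat) atTop atTop := by
    refine tendsto_atTop_mono (f := fun N : ℕ => N - k.natAbs) (fun N => by omega) ?_
    exact tendsto_sub_atTop_nat _
  refine (h.comp h2).congr' ?_
  filter_upwards [eventually_ge_atTop k.natAbs] with N hN
  obtain ⟨m, hm⟩ := Int.eq_ofNat_of_zero_le (a := (N : ℤ) + k) (by omega)
  simp only [Function.comp_apply]
  rw [hm, Int.toNat_natCast]
  simp [invQPoch]

/-- The coefficients `(-1) ^ k q ^ {k (k + 1) / 2}`. -/
noncomputable def thetaCoeff (q : ℝ) (k : ℤ) : ℝ := (-1) ^ k * q ^ (k * (k + 1) / 2)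

theorem thetaCoeff_add_one (hq0 : 0 < q) (k : ℤ) :
    thetaCoeff q (k + 1) = -q ^ (k + 1) * thetaCoeff q k := by
  have h : (k + 1) * (k + 1 + 1) / 2 = k * (k + 1) / 2 + (k + 1) := by
    rw [← Int.add_mul_ediv_right _ _ two_ne_zero]; congr 1; ring
  rw [thetaCoeff, thetaCoeff, h, zpow_add₀ hq0.ne', zpow_add_one₀ (by norm_num : (-1 : ℝ) ≠ 0)]
  ring

/-- The finite triple product: the coefficients are q-binomials `(q; q)_{2N} / ((q; q)_{N + k} (q;
q)_{N - k})` times `thetaCoeff`. Integration against `x ^ k`, `x = e ^ {2iθ}`, extracts the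
coefficient of `x ^ {-k}`, whence `k (k + 1) / 2` in the exponent. -/
theorem integral_thetaFin_even (hq0 : 0 < q) (hq1 : q < 1) (N : ℕ) (k : ℤ) :
    ∫ θ in (-Real.pi)..Real.pi, circ θ ^ (2 * k) * thetaFin q N θ =
      ((2 * Real.pi * thetaCoeff q k * qPoch q q (2 * N) * invQPoch q (N + k) *
        invQPoch q (N + -k) : ℝ) : ℂ) := by
  induction N generalizing k with
  | zero =>
    simp only [thetaFin, qPoch_zero, mul_one, integral_circ_zpow]
    rcases lt_trichotomy k 0 with hk | rfl | hk
    · rw [if_neg (by omega)]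
      obtain ⟨m, rfl⟩ := Int.eq_negSucc_of_lt_zero hk
      simp [invQPoch]
    · simp [thetaCoeff, invQPoch, qPoch_zero]
    · rw [if_neg (by omega)]
      obtain ⟨m, hm⟩ := Int.eq_negSucc_of_lt_zero (neg_neg_of_pos hk)
      rw [hm]
      simp [invQPoch]
  | succ N ih =>
    rw [integral_thetaFin_succ, show 2 * k + 2 = 2 * (k + 1) by ring,
      show 2 * k - 2 = 2 * (k - 1) by ring, ih, ih, ih]
    norm_cast
    -- All reciprocal factorials are reduced to those of index `N + 1 + k` and `N + 1 - k`, and all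
    -- theta coefficients to the `k`-th; what remains is an identity of rational functions in `q`,
    -- `q ^ N` and `q ^ k`.
    have hA : ∀ j : ℤ, invQPoch q j = (1 - q ^ (j + 1)) * invQPoch q (j + 1) := fun j => by
      rw [← invQPoch_sub_one hq0 hq1, add_sub_cancel_right]
    have t1 := thetaCoeff_add_one hq0 k
    have t0 := thetaCoeff_add_one hq0 (k - 1)
    rw [sub_add_cancel] at t0
    have hqk : q ^ k ≠ 0 := zpow_ne_zero _ hq0.ne'
    have t0' : thetaCoeff q (k - 1) = -(q ^ k)⁻¹ * thetaCoeff q k := by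
      rw [t0]; field_simp
    rw [show 2 * (N + 1) = 2 * N + 1 + 1 by ring, qPoch_self_succ, qPoch_self_succ, t1, t0',
      hA (N + k), hA (N + (k - 1)), hA (N + -k), hA (N + -(k + 1))]
    rw [show (N + (k - 1) + 1 : ℤ) = N + k by ring, show (N + -(k + 1) + 1 : ℤ) = N + -k by ring,
      hA (N + k), hA (N + -k), show (((N + 1 : ℕ) : ℤ) + k) = N + k + 1 by push_cast; ring,
      show (((N + 1 : ℕ) : ℤ) + -k) = N + -k + 1 by push_cast; ring,
      show (N + -(k - 1) : ℤ) = N + -k + 1 by ring, show (N + (k + 1) : ℤ) = N + k + 1 by ring]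
    generalize invQPoch q (N + k + 1) = A
    generalize invQPoch q (N + -k + 1) = B
    simp only [zpow_add₀ hq0.ne', zpow_neg, zpow_natCast, zpow_one, pow_succ, pow_mul']
    field_simp
    ring

theorem integral_thetaFin_odd (q : ℝ) (N : ℕ) (k : ℤ) :
    ∫ θ in (-Real.pi)..Real.pi, circ θ ^ (2 * k + 1) * thetaFin q N θ = 0 := by
  induction N generalizing k with
  | zero =>
    simp only [thetaFin, qPoch_zero, mul_one, integral_circ_zpow]
    exact if_neg (by omega)
  | succ N ih =>
    rw [integral_thetaFin_succ, show 2 * k + 1 + 2 = 2 * (k + 1) + 1 by ring,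
      show 2 * k + 1 - 2 = 2 * (k - 1) + 1 by ring, ih, ih, ih]
    ring

/-- For `‖x‖ ≤ 1` the product is dominated factor by factor by `(-1; q)_N`, a convergent sequence.
-/
theorem exists_norm_qPoch_le (hq0 : 0 < q) (hq1 : q < 1) :
    ∃ C : ℝ, 0 ≤ C ∧ ∀ (x : ℂ) (N : ℕ), ‖x‖ ≤ 1 → ‖qPoch x (q : ℂ) N‖ ≤ C := by
  obtain ⟨C, hC⟩ := (tendsto_qPoch (-1 : ℝ) (norm_lt_one_of_mem hq0 hq1)).bddAbove_range
  have hC' : ∀ N, qPoch (-1) q N ≤ C := fun N => hC ⟨N, rfl⟩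
  refine ⟨C, zero_le_one.trans (by simpa [qPoch_zero] using hC' 0), fun x N hx =>
    le_trans ?_ (hC' N)⟩
  rw [qPoch, qPoch, norm_prod]
  refine Finset.prod_le_prod (fun _ _ => norm_nonneg _) fun k _ => ?_
  refine (norm_sub_le _ _).trans ?_
  rw [norm_one, norm_mul, norm_pow, Complex.norm_real, Real.norm_eq_abs, abs_of_pos hq0]
  have := mul_le_mul_of_nonneg_right hx (pow_nonneg hq0.le k)
  linarith

theorem norm_circ_sq_inv_mul_le (hq0 : 0 < q) (hq1 : q < 1) (θ : ℝ) :
    ‖(q : ℂ) * (circ θ ^ 2)⁻¹‖ ≤ 1 := by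
  rw [norm_mul, norm_inv, norm_pow, norm_circ, one_pow, inv_one, mul_one]
  exact (norm_ofReal_lt_one hq0 hq1).le

theorem norm_circ_sq (θ : ℝ) : ‖circ θ ^ 2‖ = 1 := by rw [norm_pow, norm_circ, one_pow]

theorem tendsto_thetaFin (hq0 : 0 < q) (hq1 : q < 1) (θ : ℝ) :
    Tendsto (fun N => thetaFin q N θ) atTop (𝓝 (theta q θ)) :=
  (tendsto_qPoch _ (norm_ofReal_lt_one hq0 hq1)).mul
    (tendsto_qPoch _ (norm_ofReal_lt_one hq0 hq1))

theorem exists_norm_thetaFin_le (hq0 : 0 < q) (hq1 : q < 1) :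
    ∃ C : ℝ, ∀ (N : ℕ) (θ : ℝ), ‖thetaFin q N θ‖ ≤ C := by
  obtain ⟨C, hC0, hC⟩ := exists_norm_qPoch_le hq0 hq1
  refine ⟨C * C, fun N θ => ?_⟩
  rw [thetaFin, norm_mul]
  exact mul_le_mul (hC _ _ (norm_circ_sq θ).le) (hC _ _ (norm_circ_sq_inv_mul_le hq0 hq1 θ))
    (norm_nonneg _) hC0

theorem measurable_theta (hq0 : 0 < q) (hq1 : q < 1) : Measurable (theta q) :=
  measurable_of_tendsto_metrizable (fun N => (continuous_thetaFin q N).measurable)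
    (tendsto_pi_nhds.2 fun θ => tendsto_thetaFin hq0 hq1 θ)

theorem exists_norm_theta_le (hq0 : 0 < q) (hq1 : q < 1) :
    ∃ C : ℝ, ∀ θ : ℝ, ‖theta q θ‖ ≤ C := by
  obtain ⟨C, hC⟩ := exists_norm_thetaFin_le hq0 hq1
  exact ⟨C, fun θ => le_of_tendsto' (tendsto_thetaFin hq0 hq1 θ).norm fun N => hC N θ⟩

theorem intervalIntegrable_mul_theta (hq0 : 0 < q) (hq1 : q < 1) {f : ℝ → ℂ} (hf : Continuous f)
    (a b : ℝ) : IntervalIntegrable (fun θ => f θ * theta q θ) volume a b := by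
  obtain ⟨C, hC⟩ := exists_norm_theta_le hq0 hq1
  have := hf.intervalIntegrable (μ := volume) a b
  rw [intervalIntegrable_iff] at this ⊢
  exact this.mul_bdd (c := C) (measurable_theta hq0 hq1).aestronglyMeasurable (.of_forall hC)

theorem tendsto_integral_thetaFin (hq0 : 0 < q) (hq1 : q < 1) (j : ℤ) :
    Tendsto (fun N => ∫ θ in (-Real.pi)..Real.pi, circ θ ^ j * thetaFin q N θ) atTop
      (𝓝 (∫ θ in (-Real.pi)..Real.pi, circ θ ^ j * theta q θ)) := by
  obtain ⟨C, hC⟩ := exists_norm_thetaFin_le hq0 hq1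
  refine intervalIntegral.tendsto_integral_filter_of_dominated_convergence (fun _ => C)
    (.of_forall fun N => ?_) (.of_forall fun N => .of_forall fun θ _ => ?_)
    intervalIntegrable_const (.of_forall fun θ _ => ?_)
  · exact ((continuous_circ_zpow j).mul (continuous_thetaFin q N)).aestronglyMeasurable
  · rw [norm_mul, norm_zpow, norm_circ, one_zpow, one_mul]
    exact hC N θ
  · exact (tendsto_thetaFin hq0 hq1 θ).const_mul _

theorem integral_theta_odd (hq0 : 0 < q) (hq1 : q < 1) (k : ℤ) :
    ∫ θ in (-Real.pi)..Real.pi, circ θ ^ (2 * k + 1) * theta q θ = 0 := by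
  have := tendsto_integral_thetaFin hq0 hq1 (2 * k + 1)
  simp only [integral_thetaFin_odd] at this
  exact (tendsto_nhds_unique this tendsto_const_nhds)

/-- The Fourier expansion of the theta function: Jacobi's triple product identity. -/
theorem integral_theta_even (hq0 : 0 < q) (hq1 : q < 1) (k : ℤ) :
    ∫ θ in (-Real.pi)..Real.pi, circ θ ^ (2 * k) * theta q θ =
      ((2 * Real.pi / qPochInf q q * thetaCoeff q k : ℝ) : ℂ) := by
  have h := tendsto_integral_thetaFin hq0 hq1 (2 * k)
  simp only [integral_thetaFin_even hq0 hq1] at h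
  refine tendsto_nhds_unique h ((Complex.continuous_ofReal.tendsto _).comp ?_)
  have h2 : Tendsto (fun N : ℕ => qPoch q q (2 * N)) atTop (𝓝 (qPochInf q q)) :=
    (tendsto_qPoch q (norm_lt_one_of_mem hq0 hq1)).comp
      (tendsto_id.const_mul_atTop' (by norm_num))
  have h3 := ((h2.const_mul (2 * Real.pi * thetaCoeff q k)).mul
    (tendsto_invQPoch hq0 hq1 k)).mul (tendsto_invQPoch hq0 hq1 (-k))
  -- The q-binomial tends to `(q; q)_∞ / (q; q)_∞² = 1 / (q; q)_∞`.
  convert h3 using 2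
  have := (qPochInf_self_pos hq0 hq1).ne'
  field_simp

end tripleProduct

/-! ### Moments against the theta function and orthogonality -/

section orthogonality

variable {q : ℝ}

/-! ### Orthogonality of the continuous `q`-Hermite polynomials -/

/-- This form covers `n = 0` as well: there the truncated index `n - 1` is `0`, but its coefficient
`1 - q ^ 0` vanishes. -/
theorem two_mul_qHermite (q x : ℝ) (n : ℕ) :
    2 * x * qHermite q x n = qHermite q x (n + 1) + (1 - q ^ n) * qHermite q x (n - 1) := by
  rcases n with _ | n
  · simp [qHermite]
  · rw [qHermite_add_two]; simp

theorem continuous_qHermite (q : ℝ) (n : ℕ) : Continuous fun x => qHermite q x n := by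
  induction n using Nat.twoStepInduction with
  | zero => simpa [qHermite] using continuous_const
  | one => simp only [qHermite]; fun_prop
  | more n ih1 ih2 => simp only [qHermite_add_two]; fun_prop

/-- The mean of `e ^ {ijθ} H_n(cos θ | q)` against the theta function. -/
noncomputable def thetaMean (q : ℝ) (n : ℕ) (j : ℤ) : ℂ :=
  ∫ θ in (-Real.pi)..Real.pi, circ θ ^ j * (qHermite q (Real.cos θ) n : ℂ) * theta q θ

theorem continuous_circ_mul_qHermite (q : ℝ) (n : ℕ) (j : ℤ) :
    Continuous fun θ => circ θ ^ j * (qHermite q (Real.cos θ) n : ℂ) :=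
  (continuous_circ_zpow j).mul
    (Complex.continuous_ofReal.comp ((continuous_qHermite q n).comp Real.continuous_cos))

theorem circ_mul_qHermite_succ (q : ℝ) (n : ℕ) (j : ℤ) (θ : ℝ) :
    circ θ ^ j * (qHermite q (Real.cos θ) (n + 1) : ℂ) =
      circ θ ^ (j + 1) * (qHermite q (Real.cos θ) n : ℂ) +
        circ θ ^ (j - 1) * (qHermite q (Real.cos θ) n : ℂ) -
          (1 - q ^ n) * (circ θ ^ j * (qHermite q (Real.cos θ) (n - 1) : ℂ)) := by
  have h := congrArg (fun x : ℝ => (x : ℂ)) (two_mul_qHermite q (Real.cos θ) n)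
  push_cast at h
  rw [← Complex.ofReal_cos, ← circ_add_inv] at h
  rw [zpow_add₀ (circ_ne_zero θ), zpow_sub₀ (circ_ne_zero θ), zpow_one]
  rw [div_eq_mul_inv]
  linear_combination (-circ θ ^ j) * h

theorem thetaMean_succ (hq0 : 0 < q) (hq1 : q < 1) (n : ℕ) (j : ℤ) :
    thetaMean q (n + 1) j = thetaMean q n (j + 1) + thetaMean q n (j - 1) -
      (1 - q ^ n) * thetaMean q (n - 1) j := by
  have hi : ∀ (n : ℕ) (j : ℤ), IntervalIntegrable (fun θ =>
      circ θ ^ j * (qHermite q (Real.cos θ) n : ℂ) * theta q θ) volume (-Real.pi) Real.pi :=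
    fun n j => intervalIntegrable_mul_theta hq0 hq1 (continuous_circ_mul_qHermite q n j) _ _
  have h : ∀ θ : ℝ, circ θ ^ j * (qHermite q (Real.cos θ) (n + 1) : ℂ) * theta q θ =
      circ θ ^ (j + 1) * (qHermite q (Real.cos θ) n : ℂ) * theta q θ +
        circ θ ^ (j - 1) * (qHermite q (Real.cos θ) n : ℂ) * theta q θ -
          (1 - q ^ n) * (circ θ ^ j * (qHermite q (Real.cos θ) (n - 1) : ℂ) * theta q θ) :=
    fun θ => by rw [circ_mul_qHermite_succ]; ring
  simp only [thetaMean, h]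
  rw [intervalIntegral.integral_sub ((hi _ _).add (hi _ _)) ((hi _ _).const_mul _),
    intervalIntegral.integral_add (hi _ _) (hi _ _), intervalIntegral.integral_const_mul]

theorem thetaMean_odd (hq0 : 0 < q) (hq1 : q < 1) (n : ℕ) (s : ℤ) :
    thetaMean q n (2 * s + 1 - n) = 0 := by
  induction n using Nat.twoStepInduction generalizing s with
  | zero =>
    simpa [thetaMean, qHermite] using integral_theta_odd hq0 hq1 s
  | one =>
    rw [← zero_add 1, thetaMean_succ hq0 hq1]
    have e1 : ∀ s, thetaMean q 0 (2 * s + 1) = 0 := fun s => by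
      simpa [thetaMean, qHermite] using integral_theta_odd hq0 hq1 s
    rw [show (2 * s + 1 - ((0 + 1 : ℕ) : ℤ) + 1) = 2 * s + 1 by push_cast; ring,
      show (2 * s + 1 - ((0 + 1 : ℕ) : ℤ) - 1) = 2 * (s - 1) + 1 by push_cast; ring, e1, e1]
    simp
  | more n ih1 ih2 =>
    rw [show n + 2 = n + 1 + 1 from rfl, thetaMean_succ hq0 hq1,
      show (2 * s + 1 - ((n + 1 + 1 : ℕ) : ℤ) + 1) = 2 * s + 1 - ((n + 1 : ℕ) : ℤ) by
        push_cast; ring,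
      show (2 * s + 1 - ((n + 1 + 1 : ℕ) : ℤ) - 1) = 2 * (s - 1) + 1 - ((n + 1 : ℕ) : ℤ) by
        push_cast; ring,
      show (2 * s + 1 - ((n + 1 + 1 : ℕ) : ℤ)) = 2 * (s - 1) + 1 - (n : ℤ) by push_cast; ring,
      Nat.add_sub_cancel, ih1, ih2, ih2]
    ring

/-- The product `∏_{i < n} (1 - q ^ {s - i})` for an integer `s`. -/
noncomputable def fallingProd (q : ℝ) (n : ℕ) (s : ℤ) : ℝ :=
  ∏ i ∈ Finset.range n, (1 - q ^ (s - i))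

theorem fallingProd_succ (q : ℝ) (n : ℕ) (s : ℤ) :
    fallingProd q (n + 1) s = fallingProd q n s * (1 - q ^ (s - n)) := by
  simp [fallingProd, Finset.prod_range_succ]

theorem fallingProd_succ' (q : ℝ) (n : ℕ) (s : ℤ) :
    fallingProd q (n + 1) s = (1 - q ^ s) * fallingProd q n (s - 1) := by
  rw [fallingProd, Finset.prod_range_succ', mul_comm]
  simp [fallingProd, sub_sub, add_comm]

theorem fallingProd_eq_zero {n : ℕ} {m : ℕ} (h : m < n) : fallingProd q n m = 0 :=
  Finset.prod_eq_zero (Finset.mem_range.2 h) (by simp)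

/-- The closed form is chosen to satisfy the recurrence of `thetaMean_succ`. Its point is the factor
`fallingProd`, which vanishes for `0 ≤ s < n`. -/
theorem thetaMean_even (hq0 : 0 < q) (hq1 : q < 1) (n : ℕ) (s : ℤ) :
    thetaMean q n (2 * s - n) =
      ((2 * Real.pi / qPochInf q q * (thetaCoeff q (s - n) * fallingProd q n s) : ℝ) : ℂ) := by
  have e0 : ∀ s, thetaMean q 0 (2 * s) =
      ((2 * Real.pi / qPochInf q q * thetaCoeff q s : ℝ) : ℂ) := fun s => by
    simpa [thetaMean, qHermite] using integral_theta_even hq0 hq1 s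
  have ht : ∀ s, thetaCoeff q s = -q ^ s * thetaCoeff q (s - 1) := fun s => by
    have := thetaCoeff_add_one hq0 (s - 1)
    rwa [sub_add_cancel] at this
  induction n using Nat.twoStepInduction generalizing s with
  | zero => simpa [fallingProd] using e0 s
  | one =>
    change thetaMean q (0 + 1) (2 * s - ((0 + 1 : ℕ) : ℤ)) = _
    rw [thetaMean_succ hq0 hq1]
    rw [show (2 * s - ((0 + 1 : ℕ) : ℤ) + 1) = 2 * s by push_cast; ring,
      show (2 * s - ((0 + 1 : ℕ) : ℤ) - 1) = 2 * (s - 1) by push_cast; ring, e0, e0, ht s]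
    simp [fallingProd]
    ring
  | more n ih1 ih2 =>
    rw [show n + 2 = n + 1 + 1 from rfl, thetaMean_succ hq0 hq1,
      show (2 * s - ((n + 1 + 1 : ℕ) : ℤ) + 1) = 2 * s - ((n + 1 : ℕ) : ℤ) by
        push_cast; ring,
      show (2 * s - ((n + 1 + 1 : ℕ) : ℤ) - 1) = 2 * (s - 1) - ((n + 1 : ℕ) : ℤ) by
        push_cast; ring,
      show (2 * s - ((n + 1 + 1 : ℕ) : ℤ)) = 2 * (s - 1) - (n : ℤ) by push_cast; ring,
      Nat.add_sub_cancel, ih1, ih2, ih2, fallingProd_succ' q (n + 1), fallingProd_succ' q n s,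
      fallingProd_succ q n]
    norm_cast
    rw [ht (s - ((n + 1 : ℕ) : ℤ)),
      show s - ((n + 1 : ℕ) : ℤ) - 1 = s - ((n + 1 + 1 : ℕ) : ℤ) by push_cast; ring,
      show s - 1 - ((n + 1 : ℕ) : ℤ) = s - ((n + 1 + 1 : ℕ) : ℤ) by push_cast; ring,
      show s - 1 - (n : ℤ) = s - ((n + 1 : ℕ) : ℤ) by push_cast; ring, ht (s - ((n + 1 : ℕ) : ℤ)),
      show s - ((n + 1 : ℕ) : ℤ) - 1 = s - ((n + 1 + 1 : ℕ) : ℤ) by push_cast; ring]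
    -- The three terms now share the factors `fallingProd q n (s - 1)` and `thetaCoeff q (s - (n +
    -- 2))`; rewriting `q ^ s` leaves a polynomial identity.
    have hs : q ^ s = q ^ (s - ((n + 1 : ℕ) : ℤ)) * q ^ (n + 1) := by
      rw [← zpow_natCast q (n + 1), ← zpow_add₀ hq0.ne', sub_add_cancel]
    rw [hs]
    ring

/-- The squared modulus of `(e ^ {2iθ}; q)_∞`. -/
noncomputable def hermiteWeight (q θ : ℝ) : ℝ := ‖qPochInf (circ θ ^ 2) (q : ℂ)‖ ^ 2

theorem qPochInf_eq_mul {𝕜 : Type*} [RCLike 𝕜] (a : 𝕜) {q : 𝕜} (hq : ‖q‖ < 1) :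
    qPochInf a q = (1 - a) * qPochInf (a * q) q := by
  have h1 := (tendsto_qPoch a hq).comp (tendsto_add_atTop_nat 1)
  refine tendsto_nhds_unique h1 (((tendsto_qPoch (a * q) hq).const_mul (1 - a)).congr fun n => ?_)
  simp only [Function.comp_apply, qPoch, Finset.prod_range_succ']
  rw [mul_comm]
  simp [pow_succ', mul_assoc]

theorem conj_qPochInf (hq0 : 0 < q) (hq1 : q < 1) (a : ℂ) :
    starRingEnd ℂ (qPochInf a (q : ℂ)) = qPochInf (starRingEnd ℂ a) (q : ℂ) := by
  have hq := norm_ofReal_lt_one hq0 hq1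
  refine tendsto_nhds_unique ((Complex.continuous_conj.tendsto _).comp (tendsto_qPoch a hq))
    ((tendsto_qPoch _ hq).congr fun n => ?_)
  simp [qPoch, map_prod]

theorem conj_circ (θ : ℝ) : starRingEnd ℂ (circ θ) = (circ θ)⁻¹ := by
  rw [Complex.inv_def, Complex.normSq_eq_norm_sq, norm_circ]; simp

/-- On the unit circle the conjugate of `(x; q)_∞` is `(1 / x; q)_∞ = (1 - 1 / x)(q / x; q)_∞`. -/
theorem hermiteWeight_eq (hq0 : 0 < q) (hq1 : q < 1) (θ : ℝ) :
    (hermiteWeight q θ : ℂ) = (1 - circ θ ^ (-2 : ℤ)) * theta q θ := by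
  rw [hermiteWeight, Complex.ofReal_pow, ← Complex.mul_conj', conj_qPochInf hq0 hq1, map_pow,
    conj_circ, qPochInf_eq_mul ((circ θ)⁻¹ ^ 2) (norm_ofReal_lt_one hq0 hq1), theta, inv_pow,
    mul_comm (q : ℂ)]
  have : circ θ ^ (-2 : ℤ) = (circ θ ^ 2)⁻¹ := by rw [zpow_neg]; norm_cast
  rw [this]
  ring

/-- The integral is a difference of moments with `j = 0` and `j = -2`. For odd `n` both vanish by
parity. For `n = 2m` they correspond to `s = m` and `s = m - 1`, which lie in the vanishing range `0
≤ s < n` as soon as `m ≥ 1`; for `m = 0` the theta coefficients are `1` and `-1`, whence the factor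
`4π`. -/
theorem integral_qHermite_weight (hq0 : 0 < q) (hq1 : q < 1) (n : ℕ) :
    ∫ θ in (-Real.pi)..Real.pi, (qHermite q (Real.cos θ) n : ℂ) * (hermiteWeight q θ : ℂ) =
      if n = 0 then ((4 * Real.pi / qPochInf q q : ℝ) : ℂ) else 0 := by
  have h : ∀ θ : ℝ, (qHermite q (Real.cos θ) n : ℂ) * (hermiteWeight q θ : ℂ) =
      circ θ ^ (0 : ℤ) * (qHermite q (Real.cos θ) n : ℂ) * theta q θ -
        circ θ ^ (-2 : ℤ) * (qHermite q (Real.cos θ) n : ℂ) * theta q θ := fun θ => by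
    rw [hermiteWeight_eq hq0 hq1, zpow_zero]; ring
  simp only [h]
  rw [intervalIntegral.integral_sub
    (intervalIntegrable_mul_theta hq0 hq1 (continuous_circ_mul_qHermite q n _) _ _)
    (intervalIntegrable_mul_theta hq0 hq1 (continuous_circ_mul_qHermite q n _) _ _)]
  change thetaMean q n 0 - thetaMean q n (-2) = _
  rcases Nat.even_or_odd' n with ⟨m, rfl | rfl⟩
  · have e1 := thetaMean_even hq0 hq1 (2 * m) m
    have e2 := thetaMean_even hq0 hq1 (2 * m) ((m : ℤ) - 1)
    rw [show (2 * (m : ℤ) - ((2 * m : ℕ) : ℤ)) = 0 by push_cast; ring] at e1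
    rw [show (2 * ((m : ℤ) - 1) - ((2 * m : ℕ) : ℤ)) = -2 by push_cast; ring] at e2
    rw [e1, e2]
    rcases m with _ | m
    · simp [fallingProd, thetaCoeff]
      ring
    · rw [fallingProd_eq_zero (by omega), show (((m + 1 : ℕ) : ℤ) - 1) = (m : ℤ) by simp,
        fallingProd_eq_zero (by omega)]
      simp
  · have e1 := thetaMean_odd hq0 hq1 (2 * m + 1) m
    have e2 := thetaMean_odd hq0 hq1 (2 * m + 1) ((m : ℤ) - 1)
    rw [show (2 * (m : ℤ) + 1 - ((2 * m + 1 : ℕ) : ℤ)) = 0 by push_cast; ring] at e1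
    rw [show (2 * ((m : ℤ) - 1) + 1 - ((2 * m + 1 : ℕ) : ℤ)) = -2 by push_cast; ring] at e2
    rw [e1, e2]
    simp

theorem tendsto_norm_qPoch_circ (hq0 : 0 < q) (hq1 : q < 1) (θ : ℝ) :
    Tendsto (fun N => ‖qPoch (circ θ ^ 2) (q : ℂ) N‖ ^ 2) atTop (𝓝 (hermiteWeight q θ)) :=
  (tendsto_qPoch (circ θ ^ 2) (norm_ofReal_lt_one hq0 hq1)).norm.pow 2

theorem measurable_hermiteWeight (hq0 : 0 < q) (hq1 : q < 1) : Measurable (hermiteWeight q) := by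
  refine measurable_of_tendsto_metrizable (fun N => ?_)
    (tendsto_pi_nhds.2 fun θ => tendsto_norm_qPoch_circ hq0 hq1 θ)
  refine Continuous.measurable ?_
  unfold qPoch
  have := continuous_circ
  fun_prop

theorem exists_hermiteWeight_le (hq0 : 0 < q) (hq1 : q < 1) :
    ∃ C : ℝ, ∀ θ, hermiteWeight q θ ≤ C := by
  obtain ⟨C, hC0, hC⟩ := exists_norm_qPoch_le hq0 hq1
  exact ⟨C ^ 2, fun θ => le_of_tendsto' (tendsto_norm_qPoch_circ hq0 hq1 θ) fun N =>
    pow_le_pow_left₀ (norm_nonneg _) (hC _ _ (norm_circ_sq θ).le) 2⟩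

theorem hermiteWeight_nonneg (q θ : ℝ) : 0 ≤ hermiteWeight q θ := sq_nonneg _

theorem intervalIntegrable_mul_weight (hq0 : 0 < q) (hq1 : q < 1) {f : ℝ → ℝ}
    (hf : Continuous f) (a b : ℝ) :
    IntervalIntegrable (fun θ => f θ * hermiteWeight q θ) volume a b := by
  obtain ⟨C, hC⟩ := exists_hermiteWeight_le hq0 hq1
  have := hf.intervalIntegrable (μ := volume) a b
  rw [intervalIntegrable_iff] at this ⊢
  refine this.mul_bdd (c := C) (measurable_hermiteWeight hq0 hq1).aestronglyMeasurable
    (.of_forall fun θ => ?_)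
  rw [Real.norm_eq_abs, abs_of_nonneg (hermiteWeight_nonneg q θ)]
  exact hC θ

theorem integral_qHermite_mul_qHermite (hq0 : 0 < q) (hq1 : q < 1) (m n : ℕ) :
    ∫ θ in (-Real.pi)..Real.pi,
        qHermite q (Real.cos θ) m * qHermite q (Real.cos θ) n * hermiteWeight q θ =
      if m = n then 4 * Real.pi / qPochInf q q * qPoch q q n else 0 := by
  set A : ℕ → ℕ → ℝ := fun m n => ∫ θ in (-Real.pi)..Real.pi,
        qHermite q (Real.cos θ) m * qHermite q (Real.cos θ) n * hermiteWeight q θ with hA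
  have hi : ∀ m n, IntervalIntegrable (fun θ => qHermite q (Real.cos θ) m *
      qHermite q (Real.cos θ) n * hermiteWeight q θ) volume (-Real.pi) Real.pi := fun m n =>
    intervalIntegrable_mul_weight hq0 hq1 (((continuous_qHermite q m).comp Real.continuous_cos).mul
      ((continuous_qHermite q n).comp Real.continuous_cos)) _ _
  -- Multiplication by `2 cos θ` is symmetric: it may be expanded on `H_m` or on `H_n`. This lowers
  -- `m` and reduces everything to the integrals of a single `H_n`.
  have hrec : ∀ m n, A (m + 1) n = A m (n + 1) + (1 - q ^ n) * A m (n - 1) -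
      (1 - q ^ m) * A (m - 1) n := fun m n => by
    simp only [hA]
    rw [← intervalIntegral.integral_const_mul, ← intervalIntegral.integral_const_mul,
      ← intervalIntegral.integral_add (hi _ _) ((hi _ _).const_mul _),
      ← intervalIntegral.integral_sub ((hi _ _).add ((hi _ _).const_mul _)) ((hi _ _).const_mul _)]
    refine intervalIntegral.integral_congr fun θ _ => ?_
    have h1 := two_mul_qHermite q (Real.cos θ) m
    have h2 := two_mul_qHermite q (Real.cos θ) n
    linear_combination (-qHermite q (Real.cos θ) n * hermiteWeight q θ) * h1 +
      (qHermite q (Real.cos θ) m * hermiteWeight q θ) * h2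
  have h0 : ∀ n, A 0 n = if 0 = n then 4 * Real.pi / qPochInf q q * qPoch q q n else 0 :=
    fun n => by
    have := integral_qHermite_weight hq0 hq1 n
    simp only [← Complex.ofReal_mul] at this
    rw [intervalIntegral.integral_ofReal] at this
    simp only [hA, qHermite, one_mul]
    rcases n with _ | n
    · rw [if_pos rfl] at this ⊢
      rw [qPoch_zero, mul_one]
      exact_mod_cast this
    · rw [if_neg (Nat.succ_ne_zero n)] at this
      rw [if_neg (Nat.succ_ne_zero n).symm]
      exact_mod_cast this
  change A m n = _
  induction m using Nat.twoStepInduction generalizing n with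
  | zero => exact h0 n
  | one =>
    rw [← zero_add 1, hrec, h0, h0]
    rcases n with _ | _ | n <;> simp [qPoch, mul_comm]
  | more m ih1 ih2 =>
    rw [show m + 2 = m + 1 + 1 from rfl, hrec, ih2, ih2, Nat.add_sub_cancel, ih1]
    rcases lt_trichotomy n m with h | h | h
    · rw [if_neg (by omega), if_neg (by omega), if_neg (by omega), if_neg (by omega)]; ring
    · subst h
      rw [if_pos rfl, if_neg (by omega), if_pos rfl, if_neg (by omega), qPoch_self_succ]; ring
    · by_cases h2 : n = m + 2
      · subst h2
        rw [if_neg (by omega), if_pos (by omega), if_neg (by omega), if_pos rfl,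
          show m + 2 - 1 = m + 1 from rfl, show m + 2 = m + 1 + 1 from rfl,
          qPoch_self_succ q (m + 1)]
        ring
      · rw [if_neg (by omega), if_neg (by omega), if_neg (by omega), if_neg (by omega)]; ring

end orthogonality


/-! ### The q-Gaussian measure and its Hilbert basis -/

section gaussian

variable {q : ℝ}

/-! ### The `q`-Gaussian measure -/

theorem sqrt_one_sub_pos (hq1 : q < 1) : 0 < √(1 - q) := Real.sqrt_pos.2 (sub_pos.2 hq1)

theorem angle_mul_cos (hq1 : q < 1) {θ : ℝ} (h0 : 0 ≤ θ) (hπ : θ ≤ Real.pi) :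
    angle q (2 / √(1 - q) * Real.cos θ) = θ := by
  have := (sqrt_one_sub_pos hq1).ne'
  rw [angle, show 2 / √(1 - q) * Real.cos θ * √(1 - q) / 2 = Real.cos θ by field_simp,
    Real.arccos_cos h0 hπ]

theorem cos_angle (hq1 : q < 1) {x : ℝ} (hx : x ∈ interval q) :
    Real.cos (angle q x) = x * √(1 - q) / 2 := by
  have hs := sqrt_one_sub_pos hq1
  obtain ⟨h1, h2⟩ := hx
  rw [div_lt_iff₀ hs] at h1
  rw [lt_div_iff₀ hs] at h2
  exact Real.cos_arccos (by linarith) (by linarith)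

theorem image_cos (hq1 : q < 1) :
    (fun θ => 2 / √(1 - q) * Real.cos θ) '' Set.Ioo 0 Real.pi = interval q := by
  have hs := sqrt_one_sub_pos hq1
  ext x
  constructor
  · rintro ⟨θ, ⟨h0, hπ⟩, rfl⟩
    have h1 : Real.cos θ < 1 := by
      simpa using Real.cos_lt_cos_of_nonneg_of_le_pi le_rfl hπ.le h0
    have h2 : -1 < Real.cos θ := by
      simpa using Real.cos_lt_cos_of_nonneg_of_le_pi h0.le le_rfl hπ
    have h3 : 0 < 2 / √(1 - q) := by positivity
    refine ⟨?_, ?_⟩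
    · rw [neg_div]
      simp only
      nlinarith
    · simp only
      nlinarith
  · intro hx
    have hx' := hx
    obtain ⟨h1, h2⟩ := hx
    rw [div_lt_iff₀ hs] at h1
    rw [lt_div_iff₀ hs] at h2
    refine ⟨angle q x, ⟨Real.arccos_pos.2 (by linarith), ?_⟩, ?_⟩
    · refine lt_of_le_of_ne (Real.arccos_le_pi _) fun h => ?_
      have := Real.arccos_eq_pi.1 h
      linarith
    · simp only
      rw [cos_angle hq1 hx']
      field_simp

theorem continuous_angle (q : ℝ) : Continuous (angle q) := by
  unfold angle
  exact Real.continuous_arccos.comp (by fun_prop)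

theorem gaussianDensity_eq (hq0 : 0 < q) (hq1 : q < 1) (x : ℝ) :
    gaussianDensity q x = √(1 - q) / Real.pi * Real.sin (angle q x) *
      (qPochInf q q * ‖qPochInf (q * circ (angle q x) ^ 2) (q : ℂ)‖ ^ 2) := by
  have hq := norm_lt_one_of_mem hq0 hq1
  have hqc := norm_ofReal_lt_one hq0 hq1
  have h1 := hasProd_qPochInf q hq
  have h2 := hasProd_qPochInf (q * circ (angle q x) ^ 2) hqc
  rw [gaussianDensity]
  congr 1
  have h4 := h1.mul (h2.norm.mul h2.norm)
  rw [← sq] at h4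
  rw [← h4.tprod_eq]
  refine tprod_congr fun n => ?_
  have : Complex.exp (2 * Complex.I * (angle q x : ℂ)) = circ (angle q x) ^ 2 := by
    rw [circ, ← Complex.exp_nat_mul]; congr 1; push_cast; ring
  rw [this, ← sq]
  congr 1
  · ring
  · congr 3
    ring

theorem sin_angle_nonneg (q x : ℝ) : 0 ≤ Real.sin (angle q x) :=
  Real.sin_nonneg_of_nonneg_of_le_pi (Real.arccos_nonneg _) (Real.arccos_le_pi _)

theorem gaussianDensity_nonneg (hq0 : 0 < q) (hq1 : q < 1) (x : ℝ) : 0 ≤ gaussianDensity q x := by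
  rw [gaussianDensity_eq hq0 hq1]
  have := sin_angle_nonneg q x
  have := qPochInf_self_pos hq0 hq1
  have := Real.pi_pos
  positivity

theorem norm_one_sub_circ_sq (θ : ℝ) : ‖1 - circ θ ^ 2‖ ^ 2 = 4 * Real.sin θ ^ 2 := by
  have h : circ θ ^ 2 = (Real.cos (2 * θ) : ℂ) + (Real.sin (2 * θ) : ℂ) * Complex.I := by
    rw [Complex.ofReal_cos, Complex.ofReal_sin, ← Complex.exp_mul_I, circ, ← Complex.exp_nat_mul]
    congr 1; push_cast; ring
  rw [h, ← Complex.normSq_eq_norm_sq, Complex.normSq_apply]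
  simp only [Complex.sub_re, Complex.one_re, Complex.add_re, Complex.ofReal_re, Complex.mul_re,
    Complex.ofReal_im, Complex.I_re, Complex.I_im, Complex.sub_im, Complex.one_im, Complex.add_im,
    Complex.mul_im]
  have h1 := Real.sin_sq_add_cos_sq (2 * θ)
  have h2 := Real.cos_two_mul θ
  have h3 := Real.sin_sq_add_cos_sq θ
  nlinarith

/-- The Jacobian and the density each contribute `sin θ`; together they supply the factor `|1 - e ^
{2iθ}|² = 4 sin² θ` that completes `(q e ^ {2iθ}; q)_∞` to `(e ^ {2iθ}; q)_∞`. -/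
theorem gaussianDensity_mul_cos (hq0 : 0 < q) (hq1 : q < 1) {θ : ℝ} (h0 : 0 ≤ θ)
    (hπ : θ ≤ Real.pi) :
    2 / √(1 - q) * Real.sin θ * gaussianDensity q (2 / √(1 - q) * Real.cos θ) =
      qPochInf q q / (2 * Real.pi) * hermiteWeight q θ := by
  have h1 := (sqrt_one_sub_pos hq1).ne'
  have h2 := Real.pi_pos.ne'
  rw [gaussianDensity_eq hq0 hq1, angle_mul_cos hq1 h0 hπ, hermiteWeight,
    qPochInf_eq_mul (circ θ ^ 2) (norm_ofReal_lt_one hq0 hq1), norm_mul, mul_pow,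
    norm_one_sub_circ_sq, mul_comm (q : ℂ)]
  field_simp
  ring

theorem tendsto_norm_qPoch_mul_circ (hq0 : 0 < q) (hq1 : q < 1) (θ : ℝ) :
    Tendsto (fun N => ‖qPoch (q * circ θ ^ 2) (q : ℂ) N‖ ^ 2) atTop
      (𝓝 (‖qPochInf (q * circ θ ^ 2) (q : ℂ)‖ ^ 2)) :=
  (tendsto_qPoch _ (norm_ofReal_lt_one hq0 hq1)).norm.pow 2

theorem measurable_gaussianDensity (hq0 : 0 < q) (hq1 : q < 1) :
    Measurable (gaussianDensity q) := by
  rw [funext (gaussianDensity_eq hq0 hq1)]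
  refine Measurable.mul ?_ (Measurable.const_mul ?_ _)
  · exact ((Real.continuous_sin.comp (continuous_angle q)).measurable).const_mul _
  · refine measurable_of_tendsto_metrizable (fun N => ?_)
      (tendsto_pi_nhds.2 fun x => tendsto_norm_qPoch_mul_circ hq0 hq1 (angle q x))
    refine Continuous.measurable ?_
    unfold qPoch
    have := continuous_circ.comp (continuous_angle q)
    simp only [Function.comp_def] at this
    fun_prop

theorem measurableSet_interval (q : ℝ) : MeasurableSet (interval q) := measurableSet_Ioo

theorem ae_mem_interval (q : ℝ) : ∀ᵐ x ∂(qGaussian q), x ∈ interval q :=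
  (withDensity_absolutelyContinuous _ _).ae_le (ae_restrict_mem (measurableSet_interval q))

theorem integral_qGaussian (hq0 : 0 < q) (hq1 : q < 1) {E : Type*} [NormedAddCommGroup E]
    [NormedSpace ℝ E] (f : ℝ → E) :
    ∫ x, f x ∂(qGaussian q) = ∫ x in interval q, gaussianDensity q x • f x := by
  rw [qGaussian, integral_withDensity_eq_integral_toReal_smul
    (measurable_gaussianDensity hq0 hq1).ennreal_ofReal (.of_forall fun _ => ENNReal.ofReal_lt_top)]
  simp only [ENNReal.toReal_ofReal (gaussianDensity_nonneg hq0 hq1 _)]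

theorem integrable_qGaussian_iff (hq0 : 0 < q) (hq1 : q < 1) {E : Type*} [NormedAddCommGroup E]
    [NormedSpace ℝ E] (f : ℝ → E) :
    Integrable f (qGaussian q) ↔
      IntegrableOn (fun x => gaussianDensity q x • f x) (interval q) := by
  rw [qGaussian, integrable_withDensity_iff_integrable_smul'
    (measurable_gaussianDensity hq0 hq1).ennreal_ofReal (.of_forall fun _ => ENNReal.ofReal_lt_top)]
  simp only [ENNReal.toReal_ofReal (gaussianDensity_nonneg hq0 hq1 _)]
  rfl

theorem integral_qGaussian_eq_integral_angle (hq0 : 0 < q) (hq1 : q < 1) (f : ℝ → ℝ) :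
    ∫ x, f x ∂(qGaussian q) = qPochInf q q / (2 * Real.pi) *
      ∫ θ in (0 : ℝ)..Real.pi, f (2 / √(1 - q) * Real.cos θ) * hermiteWeight q θ := by
  have hs := sqrt_one_sub_pos hq1
  rw [integral_qGaussian hq0 hq1, ← image_cos hq1,
    integral_image_eq_integral_abs_deriv_smul measurableSet_Ioo
      (f' := fun θ => 2 / √(1 - q) * -Real.sin θ)
      (fun θ _ => ((Real.hasDerivAt_cos θ).const_mul _).hasDerivWithinAt),
    intervalIntegral.integral_of_le Real.pi_pos.le, ← integral_Ioc_eq_integral_Ioo,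
    ← integral_const_mul]
  · refine setIntegral_congr_fun measurableSet_Ioc fun θ hθ => ?_
    have h1 : 0 ≤ Real.sin θ := Real.sin_nonneg_of_nonneg_of_le_pi hθ.1.le hθ.2
    have h2 := gaussianDensity_mul_cos hq0 hq1 hθ.1.le hθ.2
    simp only [smul_eq_mul]
    rw [mul_neg, abs_neg, abs_of_nonneg (by positivity), ← mul_assoc, h2]
    ring
  · intro a ha b hb hab
    refine Real.injOn_cos ⟨ha.1.le, ha.2.le⟩ ⟨hb.1.le, hb.2.le⟩ ?_
    have h3 : 2 / √(1 - q) ≠ 0 := by positivity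
    exact mul_left_cancel₀ h3 hab

theorem basisFun_mul_cos (hq1 : q < 1) (n : ℕ) (θ : ℝ) :
    basisFun q n (2 / √(1 - q) * Real.cos θ) =
      (√(qPoch q q n))⁻¹ * qHermite q (Real.cos θ) n := by
  have := (sqrt_one_sub_pos hq1).ne'
  rw [basisFun, show 2 / √(1 - q) * Real.cos θ * √(1 - q) / 2 = Real.cos θ by field_simp]

theorem circ_neg (θ : ℝ) : circ (-θ) = starRingEnd ℂ (circ θ) := by
  rw [conj_circ, circ_inv, circ]; push_cast; ring_nf

theorem hermiteWeight_neg (hq0 : 0 < q) (hq1 : q < 1) (θ : ℝ) :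
    hermiteWeight q (-θ) = hermiteWeight q θ := by
  rw [hermiteWeight, circ_neg, ← map_pow, ← conj_qPochInf hq0 hq1, Complex.norm_conj,
    hermiteWeight]

/-- The integrand is even in `θ`, so this is half of the integral over `[-π, π]`. -/
theorem integral_zero_pi_qHermite (hq0 : 0 < q) (hq1 : q < 1) (m n : ℕ) :
    ∫ θ in (0 : ℝ)..Real.pi,
        qHermite q (Real.cos θ) m * qHermite q (Real.cos θ) n * hermiteWeight q θ =
      if m = n then 2 * Real.pi / qPochInf q q * qPoch q q n else 0 := by
  have hi : ∀ a b, IntervalIntegrable (fun θ => qHermite q (Real.cos θ) m *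
      qHermite q (Real.cos θ) n * hermiteWeight q θ) volume a b := fun a b =>
    intervalIntegrable_mul_weight hq0 hq1 (((continuous_qHermite q m).comp Real.continuous_cos).mul
      ((continuous_qHermite q n).comp Real.continuous_cos)) _ _
  have h := integral_qHermite_mul_qHermite hq0 hq1 m n
  have h2 : ∫ θ in (-Real.pi)..0,
      qHermite q (Real.cos θ) m * qHermite q (Real.cos θ) n * hermiteWeight q θ =
      ∫ θ in (0 : ℝ)..Real.pi,
        qHermite q (Real.cos θ) m * qHermite q (Real.cos θ) n * hermiteWeight q θ := by
    have := intervalIntegral.integral_comp_neg (a := 0) (b := Real.pi) (fun θ =>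
      qHermite q (Real.cos θ) m * qHermite q (Real.cos θ) n * hermiteWeight q θ)
    simp only [Real.cos_neg, hermiteWeight_neg hq0 hq1, neg_zero] at this
    exact this.symm
  rw [← intervalIntegral.integral_add_adjacent_intervals (hi _ 0) (hi _ _), h2] at h
  split_ifs at h ⊢
  · linear_combination h / 2
  · linear_combination h / 2

theorem integral_basisFun_mul_basisFun (hq0 : 0 < q) (hq1 : q < 1) (m n : ℕ) :
    ∫ x, basisFun q m x * basisFun q n x ∂(qGaussian q) = if m = n then 1 else 0 := by
  have h : ∀ θ, basisFun q m (2 / √(1 - q) * Real.cos θ) *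
      basisFun q n (2 / √(1 - q) * Real.cos θ) * hermiteWeight q θ =
      (√(qPoch q q m))⁻¹ * (√(qPoch q q n))⁻¹ *
        (qHermite q (Real.cos θ) m * qHermite q (Real.cos θ) n * hermiteWeight q θ) := fun θ => by
    rw [basisFun_mul_cos hq1, basisFun_mul_cos hq1]; ring
  rw [integral_qGaussian_eq_integral_angle hq0 hq1]
  simp only [h]
  rw [intervalIntegral.integral_const_mul, integral_zero_pi_qHermite hq0 hq1]
  split_ifs with hmn
  · subst hmn
    have h1 := (qPochInf_self_pos hq0 hq1).ne'
    have h2 := (qPoch_self_pos hq0 hq1 m).ne'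
    have h3 := Real.pi_pos.ne'
    rw [← mul_inv, Real.mul_self_sqrt (qPoch_self_pos hq0 hq1 m).le]
    field_simp
  · simp

theorem isProbabilityMeasure_qGaussian (hq0 : 0 < q) (hq1 : q < 1) :
    IsProbabilityMeasure (qGaussian q) := by
  have h := integral_basisFun_mul_basisFun hq0 hq1 0 0
  simp only [basisFun, qHermite, qPoch_zero, Real.sqrt_one, inv_one, mul_one, if_true,
    integral_const, smul_eq_mul] at h
  exact ⟨(ENNReal.toReal_eq_one_iff _).1 h⟩

/-! ### The orthonormal basis of the `q`-Hermite polynomials -/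

theorem continuous_basisFun (q : ℝ) (n : ℕ) : Continuous (basisFun q n) := by
  unfold basisFun
  exact continuous_const.mul ((continuous_qHermite q n).comp (by fun_prop))

/-- Here `|φ_n| = √(q; q)_n · |H_n / (q; q)_n|` with `(q; q)_n ≤ 1`, so the bound from the
generating function carries over. -/
theorem abs_basisFun_le (hq0 : 0 < q) (hq1 : q < 1) (n : ℕ) {x : ℝ} (hx : x ∈ interval q) :
    |basisFun q n x| ≤ (n + 1) * ((qPochInf q q)⁻¹) ^ 2 := by
  have h1 := qPoch_self_pos hq0 hq1 n
  have h2 := abs_qHermite_cos_div_le hq0 hq1 (angle q x) n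
  have h3 : qPoch q q n ≤ 1 := by
    simpa [qPoch_zero] using qPoch_self_antitone hq0 hq1 (Nat.zero_le n)
  rw [cos_angle hq1 hx, abs_div, abs_of_pos h1, div_le_iff₀ h1] at h2
  rw [basisFun, abs_mul, abs_of_pos (by positivity), inv_mul_le_iff₀ (by positivity)]
  refine h2.trans ?_
  rw [mul_comm]
  refine mul_le_mul_of_nonneg_right ?_ (by positivity)
  exact Real.le_sqrt_of_sq_le (by nlinarith)

theorem memLp_of_bound_on_interval (hq0 : 0 < q) (hq1 : q < 1) {f : ℝ → ℂ}
    (hf : AEStronglyMeasurable f (qGaussian q)) {C : ℝ} (hC : ∀ x ∈ interval q, ‖f x‖ ≤ C) :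
    MemLp f 2 (qGaussian q) := by
  have := isProbabilityMeasure_qGaussian hq0 hq1
  exact MemLp.of_bound hf C ((ae_mem_interval q).mono hC)

theorem memLp_basisFun (hq0 : 0 < q) (hq1 : q < 1) (n : ℕ) :
    MemLp (fun x => (basisFun q n x : ℂ)) 2 (qGaussian q) := by
  refine memLp_of_bound_on_interval hq0 hq1
    (Complex.continuous_ofReal.comp (continuous_basisFun q n)).aestronglyMeasurable
    (C := (n + 1) * ((qPochInf q q)⁻¹) ^ 2) fun x hx => ?_
  rw [Complex.norm_real, Real.norm_eq_abs]
  exact abs_basisFun_le hq0 hq1 n hx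

/-- The class of `φ_n` in `L²` of the `q`-Gaussian measure. -/
noncomputable def basisVec (hq0 : 0 < q) (hq1 : q < 1) (n : ℕ) : Lp ℂ 2 (qGaussian q) :=
  (memLp_basisFun hq0 hq1 n).toLp _

theorem coeFn_basisVec (hq0 : 0 < q) (hq1 : q < 1) (n : ℕ) :
    basisVec hq0 hq1 n =ᵐ[qGaussian q] fun x => (basisFun q n x : ℂ) :=
  MemLp.coeFn_toLp _

theorem inner_basisVec (hq0 : 0 < q) (hq1 : q < 1) (n : ℕ) (φ : Lp ℂ 2 (qGaussian q)) :
    inner ℂ (basisVec hq0 hq1 n) φ = ∫ x, φ x * (basisFun q n x : ℂ) ∂(qGaussian q) := by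
  rw [L2.inner_def]
  refine integral_congr_ae ?_
  filter_upwards [coeFn_basisVec hq0 hq1 n] with x hx
  rw [hx, RCLike.inner_apply, Complex.conj_ofReal]

theorem orthonormal_basisVec (hq0 : 0 < q) (hq1 : q < 1) :
    Orthonormal ℂ (basisVec hq0 hq1) := by
  rw [orthonormal_iff_ite]
  intro m n
  have : inner ℂ (basisVec hq0 hq1 m) (basisVec hq0 hq1 n) =
      ∫ x, ((basisFun q m x * basisFun q n x : ℝ) : ℂ) ∂(qGaussian q) := by
    rw [inner_basisVec]
    refine integral_congr_ae ?_
    filter_upwards [coeFn_basisVec hq0 hq1 n] with x hx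
    rw [hx]; push_cast; ring
  rw [this, integral_complex_ofReal, integral_basisFun_mul_basisFun hq0 hq1]
  split_ifs <;> simp

/-- The span of the functions `φ_n`. -/
noncomputable def basisSpan (q : ℝ) : Submodule ℂ (ℝ → ℂ) :=
  Submodule.span ℂ (Set.range fun (n : ℕ) (x : ℝ) => (basisFun q n x : ℂ))

/-- The three-term recurrence, read as multiplication by `x` on the `φ_n`. Starting from the
constant `φ_0`, it puts every polynomial in the span. -/
theorem mul_mem_basisSpan (hq0 : 0 < q) (hq1 : q < 1) {f : ℝ → ℂ} (hf : f ∈ basisSpan q) :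
    (fun x : ℝ => (x : ℂ) * f x) ∈ basisSpan q := by
  induction hf using Submodule.span_induction with
  | mem f hf =>
    obtain ⟨n, rfl⟩ := hf
    have hm : ∀ k, (fun x : ℝ => (basisFun q k x : ℂ)) ∈ basisSpan q := fun k =>
      Submodule.subset_span ⟨k, rfl⟩
    have hs := (sqrt_one_sub_pos hq1).ne'
    have hp : ∀ k, √(qPoch q q k) ≠ 0 := fun k =>
      (Real.sqrt_pos.2 (qPoch_self_pos hq0 hq1 k)).ne'
    convert (basisSpan q).add_mem
      ((basisSpan q).smul_mem (((√(1 - q))⁻¹ * (√(qPoch q q n))⁻¹ * √(qPoch q q (n + 1)) : ℝ) : ℂ)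
        (hm (n + 1)))
      ((basisSpan q).smul_mem (((√(1 - q))⁻¹ * (√(qPoch q q n))⁻¹ * (1 - q ^ n) *
        √(qPoch q q (n - 1)) : ℝ) : ℂ) (hm (n - 1))) using 1
    funext x
    simp only [Pi.add_apply, Pi.smul_apply, smul_eq_mul]
    norm_cast
    have h := two_mul_qHermite q (x * √(1 - q) / 2) n
    have hp0 := hp n
    have hp1 := hp (n + 1)
    have hp2 := hp (n - 1)
    simp only [basisFun]
    field_simp
    field_simp at h
    linear_combination h
  | zero =>
    convert (basisSpan q).zero_mem using 1
    funext x; simp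
  | add f g _ _ hf hg =>
    convert (basisSpan q).add_mem hf hg using 1
    funext x; simp [mul_add]
  | smul c f _ hf =>
    convert (basisSpan q).smul_mem c hf using 1
    funext x; simp [mul_left_comm]

theorem polynomial_mem_basisSpan (hq0 : 0 < q) (hq1 : q < 1) (p : ℂ[X]) :
    (fun x : ℝ => p.eval (x : ℂ)) ∈ basisSpan q := by
  induction p using Polynomial.induction_on' with
  | add p r hp hr =>
    convert (basisSpan q).add_mem hp hr using 1
    funext x; simp
  | monomial n a =>
    induction n with
    | zero =>
      convert (basisSpan q).smul_mem a (Submodule.subset_span ⟨0, rfl⟩) using 1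
      funext x; simp [basisFun, qHermite, qPoch_zero]
    | succ n ih =>
      convert mul_mem_basisSpan hq0 hq1 ih using 1
      funext x; simp only [eval_monomial]; ring

theorem exists_mem_span_of_mem_basisSpan (hq0 : 0 < q) (hq1 : q < 1) {f : ℝ → ℂ}
    (hf : f ∈ basisSpan q) :
    ∃ F ∈ Submodule.span ℂ (Set.range (basisVec hq0 hq1)), F =ᵐ[qGaussian q] f := by
  induction hf using Submodule.span_induction with
  | mem f hf =>
    obtain ⟨n, rfl⟩ := hf
    exact ⟨basisVec hq0 hq1 n, Submodule.subset_span ⟨n, rfl⟩, coeFn_basisVec hq0 hq1 n⟩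
  | zero => exact ⟨0, Submodule.zero_mem _, Lp.coeFn_zero _ _ _⟩
  | add f g _ _ hf hg =>
    obtain ⟨F, hF, hF'⟩ := hf
    obtain ⟨G, hG, hG'⟩ := hg
    exact ⟨F + G, Submodule.add_mem _ hF hG, (Lp.coeFn_add F G).trans (hF'.add hG')⟩
  | smul c f _ hf =>
    obtain ⟨F, hF, hF'⟩ := hf
    exact ⟨c • F, Submodule.smul_mem _ c hF, (Lp.coeFn_smul c F).trans (hF'.const_smul c)⟩

theorem exists_polynomial_near_on_interval (q : ℝ) {g : ℝ → ℂ} (hg : Continuous g) {δ : ℝ}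
    (hδ : 0 < δ) : ∃ p : ℂ[X], ∀ x ∈ interval q, ‖g x - p.eval (x : ℂ)‖ ≤ δ := by
  obtain ⟨p₁, h₁⟩ := exists_polynomial_near_of_continuousOn (-2 / √(1 - q)) (2 / √(1 - q))
    (fun x => (g x).re) (Complex.continuous_re.comp hg).continuousOn (δ / 2) (by positivity)
  obtain ⟨p₂, h₂⟩ := exists_polynomial_near_of_continuousOn (-2 / √(1 - q)) (2 / √(1 - q))
    (fun x => (g x).im) (Complex.continuous_im.comp hg).continuousOn (δ / 2) (by positivity)
  refine ⟨p₁.map Complex.ofRealHom + C Complex.I * p₂.map Complex.ofRealHom, fun x hx => ?_⟩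
  have e : ∀ p : ℝ[X], (p.map Complex.ofRealHom).eval (x : ℂ) = ((p.eval x : ℝ) : ℂ) := fun p => by
    have := Polynomial.eval_map_apply (p := p) Complex.ofRealHom x
    simpa using this
  have hx' := Set.Ioo_subset_Icc_self hx
  have b₁ := h₁ x hx'
  have b₂ := h₂ x hx'
  rw [eval_add, eval_mul, eval_C, e, e]
  have h : g x - (((p₁.eval x : ℝ) : ℂ) + Complex.I * ((p₂.eval x : ℝ) : ℂ)) =
      -((p₁.eval x - (g x).re : ℝ) : ℂ) - Complex.I * ((p₂.eval x - (g x).im : ℝ) : ℂ) := by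
    conv_lhs => rw [← Complex.re_add_im (g x)]
    push_cast
    ring
  rw [h]
  refine (norm_sub_le _ _).trans ?_
  rw [norm_neg, norm_mul, Complex.norm_I, one_mul, Complex.norm_real, Complex.norm_real,
    Real.norm_eq_abs, Real.norm_eq_abs]
  linarith

/-- Bounded continuous functions are dense in `L²`, and polynomials approximate them uniformly on
the bounded interval that carries this probability measure. The two errors of `η / 3` stay below
`η`. -/
theorem span_basisVec_dense (hq0 : 0 < q) (hq1 : q < 1) :
    (Submodule.span ℂ (Set.range (basisVec hq0 hq1))).topologicalClosure = ⊤ := by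
  have hprob := isProbabilityMeasure_qGaussian hq0 hq1
  rw [eq_top_iff]
  rintro F -
  refine EMetric.mem_closure_iff.2 fun ε hε => ?_
  obtain ⟨η, hη0, hη⟩ := ENNReal.lt_iff_exists_nnreal_btwn.1 hε
  have hη0' : (0 : ℝ) < η / 3 := by
    have : 0 < η := by exact_mod_cast hη0
    positivity
  obtain ⟨g, hg, hgm⟩ := (Lp.memLp F).exists_boundedContinuous_eLpNorm_sub_le (by simp)
    (ε := ENNReal.ofReal (η / 3)) (by simpa using hη0')
  obtain ⟨p, hp⟩ := exists_polynomial_near_on_interval q g.continuous hη0'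
  obtain ⟨G, hG, hG'⟩ := exists_mem_span_of_mem_basisSpan hq0 hq1
    (polynomial_mem_basisSpan hq0 hq1 p)
  refine ⟨G, hG, lt_of_le_of_lt ?_ hη⟩
  have hpc : Continuous fun x : ℝ => p.eval (x : ℂ) := p.continuous.comp Complex.continuous_ofReal
  rw [Lp.edist_def]
  have h1 : eLpNorm (⇑F - ⇑G) 2 (qGaussian q) ≤
      eLpNorm (⇑F - ⇑g) 2 (qGaussian q) +
        eLpNorm (⇑g - fun x : ℝ => p.eval (x : ℂ)) 2 (qGaussian q) := by
    refine le_trans (le_of_eq ?_) (eLpNorm_add_le ((Lp.aestronglyMeasurable F).sub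
      g.continuous.aestronglyMeasurable) (g.continuous.sub hpc).aestronglyMeasurable (by norm_num))
    refine eLpNorm_congr_ae ?_
    filter_upwards [hG'] with x hx
    simp [hx]
  have h2 : eLpNorm (⇑g - fun x : ℝ => p.eval (x : ℂ)) 2 (qGaussian q) ≤
      ENNReal.ofReal (η / 3) := by
    refine (eLpNorm_le_of_ae_bound ((ae_mem_interval q).mono hp)).trans ?_
    simp
  refine (h1.trans (add_le_add hg h2)).trans ?_
  rw [← ENNReal.ofReal_add hη0'.le hη0'.le, ← ENNReal.ofReal_coe_nnreal (p := η)]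
  refine ENNReal.ofReal_le_ofReal ?_
  linarith

/-- The Hilbert basis of normalized `q`-Hermite polynomials. -/
noncomputable def gaussianBasis (hq0 : 0 < q) (hq1 : q < 1) :
    HilbertBasis ℕ ℂ (Lp ℂ 2 (qGaussian q)) :=
  HilbertBasis.mk (orthonormal_basisVec hq0 hq1) (span_basisVec_dense hq0 hq1).ge

theorem gaussianBasis_apply (hq0 : 0 < q) (hq1 : q < 1) (n : ℕ) :
    gaussianBasis hq0 hq1 n = basisVec hq0 hq1 n := by
  rw [gaussianBasis, HilbertBasis.coe_mk]

end gaussian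


/-! ### The Arik–Coon space: moments, monomial basis, point evaluations -/

section arikCoon

variable {q : ℝ}

/-! ### Moments of the Arik–Coon measure -/

theorem qFactorial_eq (q : ℝ) (n : ℕ) : qFactorial q n = qPoch q q n / (1 - q) ^ n := by
  simp only [qFactorial, qPoch, qNumber, Finset.prod_div_distrib, pow_succ' q, Finset.prod_const,
    Finset.card_range]

theorem qFactorial_pos (hq0 : 0 < q) (hq1 : q < 1) (n : ℕ) : 0 < qFactorial q n := by
  rw [qFactorial_eq]
  exact div_pos (qPoch_self_pos hq0 hq1 n) (pow_pos (sub_pos.2 hq1) n)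

theorem sqrt_qFactorial_ne_zero (hq0 : 0 < q) (hq1 : q < 1) (n : ℕ) :
    ((√(qFactorial q n) : ℝ) : ℂ) ≠ 0 := by
  exact_mod_cast (Real.sqrt_pos.2 (qFactorial_pos hq0 hq1 n)).ne'

theorem qPochInf_eq_qPoch_mul {𝕜 : Type*} [RCLike 𝕜] (a : 𝕜) {q : 𝕜} (hq : ‖q‖ < 1) (n : ℕ) :
    qPochInf a q = qPoch a q n * qPochInf (a * q ^ n) q := by
  induction n with
  | zero => simp [qPoch_zero]
  | succ n ih =>
    rw [ih, qPochInf_eq_mul (a * q ^ n) hq, qPoch_succ, pow_succ, mul_assoc, mul_assoc]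

theorem continuous_mul_circ (r : ℝ) : Continuous fun θ : ℝ => (r : ℂ) * circ θ :=
  continuous_const.mul continuous_circ

theorem circleMeasure_eq (r : ℝ) : circleMeasure r = ENNReal.ofReal (1 / (2 * Real.pi)) •
    (volume.restrict (Set.Ico (0 : ℝ) (2 * Real.pi))).map fun θ : ℝ => (r : ℂ) * circ θ := rfl

theorem isProbabilityMeasure_circleMeasure (r : ℝ) : IsProbabilityMeasure (circleMeasure r) := by
  have := Real.pi_pos
  refine ⟨?_⟩
  rw [circleMeasure_eq, Measure.smul_apply, Measure.map_apply (continuous_mul_circ r).measurable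
    MeasurableSet.univ, Set.preimage_univ, Measure.restrict_apply_univ, Real.volume_Ico, smul_eq_mul,
    ← ENNReal.ofReal_mul (by positivity), sub_zero, one_div_mul_cancel (by positivity),
    ENNReal.ofReal_one]

theorem integral_circleMeasure (r : ℝ) {g : ℂ → ℂ} (hg : Continuous g) :
    ∫ w, g w ∂(circleMeasure r) =
      (1 / (2 * Real.pi) : ℝ) • ∫ θ in (0 : ℝ)..(2 * Real.pi), g (r * circ θ) := by
  have := Real.pi_pos
  rw [circleMeasure_eq, integral_smul_measure, integral_map
    (continuous_mul_circ r).measurable.aemeasurable hg.aestronglyMeasurable,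
    ENNReal.toReal_ofReal (by positivity), intervalIntegral.integral_of_le (by positivity),
    ← integral_Ico_eq_integral_Ioc]

theorem circ_periodic (j : ℤ) : Function.Periodic (fun θ => circ θ ^ j) (2 * Real.pi) := fun θ => by
  have : circ (θ + 2 * Real.pi) = circ θ := by
    rw [circ, circ]
    push_cast
    rw [show Complex.I * ((θ : ℂ) + 2 * Real.pi) = Complex.I * θ + 2 * Real.pi * Complex.I by ring,
      Complex.exp_periodic]
  simp only [this]

theorem integral_zero_two_pi_circ_zpow (j : ℤ) :
    ∫ θ in (0 : ℝ)..(2 * Real.pi), circ θ ^ j = if j = 0 then 2 * (Real.pi : ℂ) else 0 := by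
  rw [← integral_circ_zpow j]
  have := (circ_periodic j).intervalIntegral_add_eq 0 (-Real.pi)
  rwa [zero_add, show -Real.pi + 2 * Real.pi = Real.pi by ring] at this

theorem integral_monomials_circleMeasure (r : ℝ) (m n : ℕ) :
    ∫ w, w ^ n * starRingEnd ℂ (w ^ m) ∂(circleMeasure r) =
      if m = n then (((r ^ 2) ^ n : ℝ) : ℂ) else 0 := by
  rw [integral_circleMeasure r (by fun_prop)]
  have h : ∀ θ : ℝ, ((r : ℂ) * circ θ) ^ n * starRingEnd ℂ (((r : ℂ) * circ θ) ^ m) =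
      (r : ℂ) ^ (m + n) * circ θ ^ ((n : ℤ) - m) := fun θ => by
    rw [map_pow, map_mul, Complex.conj_ofReal, conj_circ, zpow_sub₀ (circ_ne_zero θ), zpow_natCast,
      zpow_natCast, mul_pow, mul_pow, inv_pow, pow_add]
    ring
  simp only [h]
  rw [intervalIntegral.integral_const_mul, integral_zero_two_pi_circ_zpow]
  by_cases hmn : m = n
  · subst hmn
    have := Real.pi_ne_zero
    rw [if_pos (sub_self _), if_pos rfl, Complex.real_smul]
    push_cast
    field_simp
    ring_nf
  · rw [if_neg (by omega), if_neg hmn]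
    simp

theorem weight_nonneg (hq0 : 0 < q) (hq1 : q < 1) (n : ℕ) :
    0 ≤ qPochInf q q * (q ^ n / qPoch q q n) :=
  mul_nonneg (qPochInf_self_pos hq0 hq1).le
    (div_nonneg (pow_nonneg hq0.le n) (qPoch_self_pos hq0 hq1 n).le)

/-- Euler's sum at `t = q ^ {n + 1}` gives `(q; q)_∞ / (q ^ {n + 1}; q)_∞ = (q; q)_n`, and the radii
contribute `(1 - q) ^ {-n}`. -/
theorem hasSum_moment (hq0 : 0 < q) (hq1 : q < 1) (n : ℕ) :
    HasSum (fun k => qPochInf q q * (q ^ k / qPoch q q k) * ((√(q ^ k) / √(1 - q)) ^ 2) ^ n)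
      (qFactorial q n) := by
  have hqc := norm_ofReal_lt_one hq0 hq1
  have ht : ‖((q : ℂ) * q ^ n)‖ < 1 := by
    rw [norm_mul, norm_pow]
    exact lt_of_le_of_lt (mul_le_of_le_one_right (norm_nonneg _)
      (pow_le_one₀ (norm_nonneg _) hqc.le)) hqc
  have h := (hasSum_euler hq0 hq1 ht).mul_left ((qPochInf (q : ℂ) q) / ((1 - q : ℝ) : ℂ) ^ n)
  have hcast : ((qPochInf q q : ℝ) : ℂ) = qPochInf (q : ℂ) q := by
    refine tendsto_nhds_unique ((Complex.continuous_ofReal.tendsto _).comp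
      (tendsto_qPoch q (norm_lt_one_of_mem hq0 hq1))) ((tendsto_qPoch _ hqc).congr fun N => ?_)
    simp [qPoch]
  have hcast' : ((qPoch q q n : ℝ) : ℂ) = qPoch (q : ℂ) q n := by simp [qPoch]
  rw [← Complex.hasSum_ofReal]
  have hne := qPochInf_ne_zero ht hqc
  have h1q : (1 - q : ℝ) ≠ 0 := (sub_pos.2 hq1).ne'
  have h1q' : ((1 - q : ℝ) : ℂ) ≠ 0 := by exact_mod_cast h1q
  convert! h using 1
  · funext k
    rw [div_pow, Real.sq_sqrt (pow_nonneg hq0.le k), Real.sq_sqrt (sub_pos.2 hq1).le, ← hcast,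
      div_pow]
    push_cast
    ring
  · rw [qFactorial_eq, qPochInf_eq_qPoch_mul (q : ℂ) hqc n, Complex.ofReal_div, hcast',
      Complex.ofReal_pow]
    field_simp

theorem isProbabilityMeasure_arikCoonMeasure (hq0 : 0 < q) (hq1 : q < 1) :
    IsProbabilityMeasure (arikCoonMeasure q) := by
  have := fun r => isProbabilityMeasure_circleMeasure r
  refine ⟨?_⟩
  rw [arikCoonMeasure, Measure.sum_apply _ MeasurableSet.univ]
  simp only [Measure.smul_apply, measure_univ, smul_eq_mul, mul_one]
  have h := hasSum_moment hq0 hq1 0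
  simp only [pow_zero, mul_one, qFactorial, Finset.range_zero, Finset.prod_empty] at h
  rw [← ENNReal.ofReal_tsum_of_nonneg (weight_nonneg hq0 hq1) h.summable, h.tsum_eq,
    ENNReal.ofReal_one]

/-- Compact support makes every continuous function square integrable. The bound is not strict: the
circle with `n = 0` is the boundary of `ℂ_q`. -/
theorem ae_norm_le_arikCoonMeasure (hq0 : 0 < q) (hq1 : q < 1) :
    ∀ᵐ w ∂(arikCoonMeasure q), ‖w‖ ≤ 1 / √(1 - q) := by
  rw [arikCoonMeasure, Measure.ae_sum_iff' (measurableSet_le measurable_norm measurable_const)]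
  refine fun n => Measure.ae_smul_measure ?_ _
  rw [circleMeasure_eq]
  refine Measure.ae_smul_measure ?_ _
  rw [ae_map_iff (continuous_mul_circ _).measurable.aemeasurable
    (measurableSet_le measurable_norm measurable_const)]
  refine .of_forall fun θ => ?_
  rw [norm_mul, norm_circ, mul_one, Complex.norm_real, Real.norm_eq_abs, abs_of_nonneg
    (by positivity)]
  refine div_le_div_of_nonneg_right ?_ (Real.sqrt_nonneg _)
  exact Real.sqrt_le_one.2 (pow_le_one₀ hq0.le hq1.le)

theorem exists_ae_norm_le_of_continuous (hq0 : 0 < q) (hq1 : q < 1) {g : ℂ → ℂ}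
    (hg : Continuous g) : ∃ C : ℝ, ∀ᵐ w ∂(arikCoonMeasure q), ‖g w‖ ≤ C := by
  obtain ⟨C, hC⟩ := (isCompact_closedBall (0 : ℂ) (1 / √(1 - q))).exists_bound_of_continuousOn
    hg.continuousOn
  exact ⟨C, (ae_norm_le_arikCoonMeasure hq0 hq1).mono fun w hw => hC w (by simpa using hw)⟩

theorem memLp_of_continuous (hq0 : 0 < q) (hq1 : q < 1) {g : ℂ → ℂ} (hg : Continuous g)
    (p : ENNReal) : MemLp g p (arikCoonMeasure q) := by
  have := isProbabilityMeasure_arikCoonMeasure hq0 hq1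
  obtain ⟨C, hC⟩ := exists_ae_norm_le_of_continuous hq0 hq1 hg
  exact MemLp.of_bound hg.aestronglyMeasurable C hC

theorem integral_monomials_arikCoonMeasure (hq0 : 0 < q) (hq1 : q < 1) (m n : ℕ) :
    ∫ w, w ^ n * starRingEnd ℂ (w ^ m) ∂(arikCoonMeasure q) =
      if m = n then (qFactorial q n : ℂ) else 0 := by
  have hint : Integrable (fun w : ℂ => w ^ n * starRingEnd ℂ (w ^ m)) (arikCoonMeasure q) :=
    memLp_one_iff_integrable.1 (memLp_of_continuous hq0 hq1 (by fun_prop) 1)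
  have h := hasSum_integral_measure hint
  refine h.unique ?_
  simp only [integral_smul_measure, integral_monomials_circleMeasure,
    ENNReal.toReal_ofReal (weight_nonneg hq0 hq1 _)]
  split_ifs with hmn
  · have h2 := (Complex.hasSum_ofReal).2 (hasSum_moment hq0 hq1 n)
    simpa using h2
  · simp [hasSum_zero]

/-! ### The orthonormal basis of monomials and the reproducing vectors -/

/-- The class of a polynomial in `L²` of the Arik–Coon measure. -/
noncomputable def polyVec (hq0 : 0 < q) (hq1 : q < 1) (p : ℂ[X]) : Lp ℂ 2 (arikCoonMeasure q) :=
  (memLp_of_continuous hq0 hq1 p.continuous 2).toLp _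

theorem coeFn_polyVec (hq0 : 0 < q) (hq1 : q < 1) (p : ℂ[X]) :
    polyVec hq0 hq1 p =ᵐ[arikCoonMeasure q] fun w => p.eval w :=
  MemLp.coeFn_toLp _

theorem polyVec_add (hq0 : 0 < q) (hq1 : q < 1) (p r : ℂ[X]) :
    polyVec hq0 hq1 (p + r) = polyVec hq0 hq1 p + polyVec hq0 hq1 r := by
  refine Lp.ext ?_
  filter_upwards [coeFn_polyVec hq0 hq1 (p + r), coeFn_polyVec hq0 hq1 p, coeFn_polyVec hq0 hq1 r,
    Lp.coeFn_add (polyVec hq0 hq1 p) (polyVec hq0 hq1 r)] with w h1 h2 h3 h4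
  rw [h1, h4, Pi.add_apply, h2, h3, eval_add]

theorem polyVec_C_mul (hq0 : 0 < q) (hq1 : q < 1) (c : ℂ) (p : ℂ[X]) :
    polyVec hq0 hq1 (C c * p) = c • polyVec hq0 hq1 p := by
  refine Lp.ext ?_
  filter_upwards [coeFn_polyVec hq0 hq1 (C c * p), coeFn_polyVec hq0 hq1 p,
    Lp.coeFn_smul c (polyVec hq0 hq1 p)] with w h1 h2 h3
  rw [h1, h3, Pi.smul_apply, h2, eval_mul, eval_C, smul_eq_mul]

/-- The class of `z ^ n / √([n]_q!)` in `L²` of the Arik–Coon measure. -/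
noncomputable def monomVec (hq0 : 0 < q) (hq1 : q < 1) (n : ℕ) : Lp ℂ 2 (arikCoonMeasure q) :=
  polyVec hq0 hq1 (C (((√(qFactorial q n) : ℝ) : ℂ)⁻¹) * X ^ n)

theorem coeFn_monomVec (hq0 : 0 < q) (hq1 : q < 1) (n : ℕ) :
    monomVec hq0 hq1 n =ᵐ[arikCoonMeasure q] fun w => w ^ n / ((√(qFactorial q n) : ℝ) : ℂ) := by
  filter_upwards [coeFn_polyVec hq0 hq1 (C (((√(qFactorial q n) : ℝ) : ℂ)⁻¹) * X ^ n)] with w hw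
  rw [monomVec, hw, eval_mul, eval_C, eval_pow, eval_X, div_eq_inv_mul]

theorem polyVec_monomial (hq0 : 0 < q) (hq1 : q < 1) (n : ℕ) (c : ℂ) :
    polyVec hq0 hq1 (monomial n c) =
      (c * ((√(qFactorial q n) : ℝ) : ℂ)) • monomVec hq0 hq1 n := by
  rw [monomVec, ← polyVec_C_mul, ← mul_assoc, ← C_mul, mul_assoc,
    mul_inv_cancel₀ (sqrt_qFactorial_ne_zero hq0 hq1 n), mul_one, C_mul_X_pow_eq_monomial]

theorem orthonormal_monomVec (hq0 : 0 < q) (hq1 : q < 1) :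
    Orthonormal ℂ (monomVec hq0 hq1) := by
  rw [orthonormal_iff_ite]
  intro m n
  have : inner ℂ (monomVec hq0 hq1 m) (monomVec hq0 hq1 n) =
      (((√(qFactorial q n) : ℝ) : ℂ)⁻¹ * ((√(qFactorial q m) : ℝ) : ℂ)⁻¹) *
        ∫ w, w ^ n * starRingEnd ℂ (w ^ m) ∂(arikCoonMeasure q) := by
    rw [L2.inner_def, ← integral_const_mul]
    refine integral_congr_ae ?_
    filter_upwards [coeFn_monomVec hq0 hq1 m, coeFn_monomVec hq0 hq1 n] with w h1 h2
    rw [h1, h2, RCLike.inner_apply, map_div₀, Complex.conj_ofReal]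
    ring
  rw [this, integral_monomials_arikCoonMeasure hq0 hq1]
  split_ifs with hmn
  · subst hmn
    have h1 := sqrt_qFactorial_ne_zero hq0 hq1 m
    have h2 : (qFactorial q m : ℂ) =
        ((√(qFactorial q m) : ℝ) : ℂ) * ((√(qFactorial q m) : ℝ) : ℂ) := by
      rw [← Complex.ofReal_mul, Real.mul_self_sqrt (qFactorial_pos hq0 hq1 m).le]
    rw [h2]
    field_simp
  · rw [mul_zero]

theorem arikCoonSpace_eq (hq0 : 0 < q) (hq1 : q < 1) : arikCoonSpace q =
    (Submodule.span ℂ (Set.range (monomVec hq0 hq1))).topologicalClosure := by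
  rw [arikCoonSpace]
  congr 2
  ext F
  constructor
  · rintro ⟨n, hn⟩
    exact ⟨n, Lp.ext ((coeFn_monomVec hq0 hq1 n).trans hn.symm)⟩
  · rintro ⟨n, rfl⟩
    exact ⟨n, coeFn_monomVec hq0 hq1 n⟩

theorem monomVec_mem (hq0 : 0 < q) (hq1 : q < 1) (n : ℕ) :
    monomVec hq0 hq1 n ∈ arikCoonSpace q := by
  rw [arikCoonSpace_eq hq0 hq1]
  exact Submodule.le_topologicalClosure _ (Submodule.subset_span ⟨n, rfl⟩)

theorem exists_polyVec_eq (hq0 : 0 < q) (hq1 : q < 1) {F : Lp ℂ 2 (arikCoonMeasure q)}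
    (hF : F ∈ Submodule.span ℂ (Set.range (monomVec hq0 hq1))) :
    ∃ p : ℂ[X], polyVec hq0 hq1 p = F := by
  induction hF using Submodule.span_induction with
  | mem F hF =>
    obtain ⟨n, rfl⟩ := hF
    exact ⟨_, rfl⟩
  | zero => exact ⟨C 0 * 0, by rw [polyVec_C_mul, zero_smul]⟩
  | add F G _ _ hF hG =>
    obtain ⟨p, rfl⟩ := hF
    obtain ⟨r, rfl⟩ := hG
    exact ⟨p + r, polyVec_add hq0 hq1 p r⟩
  | smul c F _ hF =>
    obtain ⟨p, rfl⟩ := hF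
    exact ⟨C c * p, polyVec_C_mul hq0 hq1 c p⟩

/-- The modulus of `z √(1 - q)` is less than `1` for `z ∈ ℂ_q`. -/
theorem norm_mul_sqrt_lt_one (hq1 : q < 1) (z : disc q) :
    ‖(z : ℂ) * (√(1 - q) : ℝ)‖ < 1 := by
  have h : (1 - q) * ‖(z : ℂ)‖ ^ 2 < 1 := z.2
  rw [norm_mul, Complex.norm_real, Real.norm_eq_abs, abs_of_pos (sqrt_one_sub_pos hq1)]
  refine (sq_lt_one_iff₀ (by positivity)).1 ?_
  rw [mul_pow, Real.sq_sqrt (sub_pos.2 hq1).le]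
  linarith

theorem sqrt_qFactorial_eq (hq0 : 0 < q) (hq1 : q < 1) (n : ℕ) :
    √(qFactorial q n) = √(qPoch q q n) / √(1 - q) ^ n := by
  have h : (1 - q) ^ n = (√(1 - q) ^ n) ^ 2 := by
    rw [← pow_mul, mul_comm, pow_mul, Real.sq_sqrt (sub_pos.2 hq1).le]
  rw [qFactorial_eq, Real.sqrt_div (qPoch_self_pos hq0 hq1 n).le, h,
    Real.sqrt_sq (pow_nonneg (Real.sqrt_nonneg _) n)]

theorem norm_pow_div_le (hq0 : 0 < q) (hq1 : q < 1) (z : ℂ) (n : ℕ) :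
    ‖z ^ n / ((√(qFactorial q n) : ℝ) : ℂ)‖ ≤
      ‖z * (√(1 - q) : ℝ)‖ ^ n * (qPochInf q q)⁻¹ := by
  have hs := sqrt_one_sub_pos hq1
  have hp := qPoch_self_pos hq0 hq1 n
  have h1 : qPoch q q n ≤ √(qPoch q q n) := by
    refine Real.le_sqrt_of_sq_le ?_
    have : qPoch q q n ≤ 1 := by
      simpa [qPoch_zero] using qPoch_self_antitone hq0 hq1 (Nat.zero_le n)
    nlinarith
  rw [norm_div, norm_pow, norm_mul, Complex.norm_real, Complex.norm_real, Real.norm_eq_abs,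
    Real.norm_eq_abs, abs_of_nonneg (Real.sqrt_nonneg _), abs_of_pos hs,
    sqrt_qFactorial_eq hq0 hq1, mul_pow, div_div_eq_mul_div, div_eq_mul_inv]
  refine mul_le_mul_of_nonneg_left ?_ (by positivity)
  exact (inv_anti₀ hp h1).trans (inv_qPoch_self_le hq0 hq1 n)

theorem summable_norm_pow_div (hq0 : 0 < q) (hq1 : q < 1) (z : disc q) :
    Summable fun n : ℕ => ‖(z : ℂ) ^ n / ((√(qFactorial q n) : ℝ) : ℂ)‖ :=
  Summable.of_nonneg_of_le (fun _ => norm_nonneg _) (norm_pow_div_le hq0 hq1 z)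
    ((summable_geometric_of_lt_one (norm_nonneg _) (norm_mul_sqrt_lt_one hq1 z)).mul_right _)

/-- The vector representing evaluation at `z`. -/
noncomputable def evalVec (hq0 : 0 < q) (hq1 : q < 1) (z : disc q) : Lp ℂ 2 (arikCoonMeasure q) :=
  ∑' n : ℕ, starRingEnd ℂ ((z : ℂ) ^ n / ((√(qFactorial q n) : ℝ) : ℂ)) • monomVec hq0 hq1 n

theorem hasSum_inner_evalVec (hq0 : 0 < q) (hq1 : q < 1) (z : disc q)
    (F : Lp ℂ 2 (arikCoonMeasure q)) :
    HasSum (fun n : ℕ => (z : ℂ) ^ n / ((√(qFactorial q n) : ℝ) : ℂ) *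
      inner ℂ (monomVec hq0 hq1 n) F) (inner ℂ (evalVec hq0 hq1 z) F) := by
  have h : Summable fun n : ℕ =>
      starRingEnd ℂ ((z : ℂ) ^ n / ((√(qFactorial q n) : ℝ) : ℂ)) • monomVec hq0 hq1 n := by
    refine Summable.of_norm ?_
    simp only [norm_smul, (orthonormal_monomVec hq0 hq1).1, mul_one, RCLike.norm_conj]
    exact summable_norm_pow_div hq0 hq1 z
  -- The scalar product is linear in its second argument, so the series is paired with `F` on the
  -- left and then conjugated.
  have h2 := ((innerSL ℂ F).hasSum h.hasSum).star
  simpa [inner_smul_right, inner_conj_symm, evalVec] using h2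

/-- The reproducing property. As `evalVec` lies in `L²`, convergence of polynomials there forces
their convergence at each `z ∈ ℂ_q`, which gives both existence and uniqueness of the representing
function. -/
theorem inner_evalVec_polyVec (hq0 : 0 < q) (hq1 : q < 1) (z : disc q) (p : ℂ[X]) :
    inner ℂ (evalVec hq0 hq1 z) (polyVec hq0 hq1 p) = p.eval (z : ℂ) := by
  induction p using Polynomial.induction_on' with
  | add p r hp hr => rw [polyVec_add, inner_add_right, hp, hr, eval_add]
  | monomial n c =>
    refine (hasSum_inner_evalVec hq0 hq1 z _).unique ?_
    simp only [polyVec_monomial, inner_smul_right,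
      orthonormal_iff_ite.1 (orthonormal_monomVec hq0 hq1), eval_monomial]
    have := hasSum_ite_eq n (c * (z : ℂ) ^ n)
    convert this using 2 with k
    split_ifs with hk
    · subst hk
      have := sqrt_qFactorial_ne_zero hq0 hq1 k
      field_simp
    · ring

theorem tendsto_polyVec_iff (hq0 : 0 < q) (hq1 : q < 1) (F : Lp ℂ 2 (arikCoonMeasure q))
    (p : ℕ → ℂ[X]) :
    Tendsto (fun k => polyVec hq0 hq1 (p k)) atTop (𝓝 F) ↔
      Tendsto (fun k => eLpNorm (fun w : ℂ => F w - (p k).eval w) 2 (arikCoonMeasure q))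
        atTop (𝓝 0) := by
  rw [Lp.tendsto_Lp_iff_tendsto_eLpNorm']
  refine iff_of_eq (congrArg (fun s => Tendsto s atTop (𝓝 0)) (funext fun k => ?_))
  rw [← eLpNorm_neg]
  refine eLpNorm_congr_ae ?_
  filter_upwards [coeFn_polyVec hq0 hq1 (p k)] with w hw
  simp [hw]

theorem HasValues.eq_inner {F : Lp ℂ 2 (arikCoonMeasure q)} {f : disc q → ℂ}
    (h : HasValues q F f) (hq0 : 0 < q) (hq1 : q < 1) (z : disc q) :
    f z = inner ℂ (evalVec hq0 hq1 z) F := by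
  obtain ⟨p, h1, h2⟩ := h
  have h3 := ((tendsto_polyVec_iff hq0 hq1 F p).2 h1)
  have h4 : Tendsto (fun k => inner ℂ (evalVec hq0 hq1 z) (polyVec hq0 hq1 (p k))) atTop
      (𝓝 (inner ℂ (evalVec hq0 hq1 z) F)) := tendsto_const_nhds.inner h3
  exact tendsto_nhds_unique (h2 z) (h4.congr fun k => inner_evalVec_polyVec hq0 hq1 z (p k))

theorem hasValues_inner (hq0 : 0 < q) (hq1 : q < 1) (F : arikCoonSpace q) :
    HasValues q F fun z => inner ℂ (evalVec hq0 hq1 z) (F : Lp ℂ 2 (arikCoonMeasure q)) := by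
  obtain ⟨F, hF⟩ := F
  rw [arikCoonSpace_eq hq0 hq1] at hF
  obtain ⟨x, hx, hx'⟩ := mem_closure_iff_seq_limit.1 hF
  choose p hp using fun k => exists_polyVec_eq hq0 hq1 (hx k)
  rw [show x = fun k => polyVec hq0 hq1 (p k) from funext fun k => (hp k).symm] at hx'
  refine ⟨p, (tendsto_polyVec_iff hq0 hq1 F p).1 hx', fun z => ?_⟩
  have h4 : Tendsto (fun k => inner ℂ (evalVec hq0 hq1 z) (polyVec hq0 hq1 (p k))) atTop
      (𝓝 (inner ℂ (evalVec hq0 hq1 z) F)) := tendsto_const_nhds.inner hx'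
  exact h4.congr fun k => inner_evalVec_polyVec hq0 hq1 z (p k)

theorem eq_zero_of_inner_monomVec (hq0 : 0 < q) (hq1 : q < 1) {F : Lp ℂ 2 (arikCoonMeasure q)}
    (hF : F ∈ arikCoonSpace q) (h : ∀ n, inner ℂ (monomVec hq0 hq1 n) F = 0) : F = 0 := by
  rw [arikCoonSpace_eq hq0 hq1] at hF
  have h1 : F ∈ (Submodule.span ℂ (Set.range (monomVec hq0 hq1)))ᗮ := by
    rw [Submodule.mem_orthogonal]
    intro u hu
    induction hu using Submodule.span_induction with
    | mem u hu => obtain ⟨n, rfl⟩ := hu; exact h n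
    | zero => exact inner_zero_left _
    | add u v _ _ hu hv => rw [inner_add_left, hu, hv, add_zero]
    | smul c u _ hu => rw [inner_smul_left, hu, mul_zero]
  rw [← Submodule.orthogonal_closure] at h1
  exact inner_self_eq_zero.1 (h1 F hF)

theorem coeff_eq_zero_of_hasSum_zero {a : ℕ → ℂ}
    (h : ∀ᶠ z in 𝓝 (0 : ℂ), HasSum (fun n => z ^ n * a n) 0) (n : ℕ) : a n = 0 := by
  have h1 : HasFPowerSeriesAt (0 : ℂ → ℂ) (FormalMultilinearSeries.ofScalars ℂ a) 0 := by
    rw [hasFPowerSeriesAt_iff]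
    simpa using h
  have h2 : (FormalMultilinearSeries.ofScalars ℂ a).coeff n = 0 := by
    rw [h1.eq_zero]; rfl
  rwa [FormalMultilinearSeries.coeff_ofScalars] at h2

/-- The values form a power series near `0` whose coefficients are the coordinates of `F` up to
nonzero factors; if it vanishes, so do all coordinates. -/
theorem eq_zero_of_inner_evalVec (hq0 : 0 < q) (hq1 : q < 1) {F : Lp ℂ 2 (arikCoonMeasure q)}
    (hF : F ∈ arikCoonSpace q) (h : ∀ z, inner ℂ (evalVec hq0 hq1 z) F = 0) : F = 0 := by
  refine eq_zero_of_inner_monomVec hq0 hq1 hF fun n => ?_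
  have h1 : ∀ᶠ z in 𝓝 (0 : ℂ), HasSum (fun n => z ^ n *
      (inner ℂ (monomVec hq0 hq1 n) F / ((√(qFactorial q n) : ℝ) : ℂ))) 0 := by
    have ho : IsOpen (disc q) := isOpen_lt (by fun_prop) continuous_const
    filter_upwards [ho.mem_nhds (show (0 : ℂ) ∈ disc q by simp [disc])] with z hz
    have h2 := hasSum_inner_evalVec hq0 hq1 ⟨z, hz⟩ F
    rw [h] at h2
    convert h2 using 2
    ring
  have h3 := coeff_eq_zero_of_hasSum_zero h1 n
  exact (div_eq_zero_iff.1 h3).resolve_right (sqrt_qFactorial_ne_zero hq0 hq1 n)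

instance completeSpace_arikCoonSpace (q : ℝ) : CompleteSpace (arikCoonSpace q) :=
  (Submodule.isClosed_topologicalClosure _).completeSpace_coe

/-- The monomials `z ^ n / √([n]_q!)` as elements of the Arik–Coon space. -/
noncomputable def monomElem (hq0 : 0 < q) (hq1 : q < 1) (n : ℕ) : arikCoonSpace q :=
  ⟨monomVec hq0 hq1 n, monomVec_mem hq0 hq1 n⟩

theorem orthonormal_monomElem (hq0 : 0 < q) (hq1 : q < 1) :
    Orthonormal ℂ (monomElem hq0 hq1) := by
  have := orthonormal_monomVec hq0 hq1
  rw [orthonormal_iff_ite] at this ⊢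
  exact this

theorem orthogonal_span_monomElem (hq0 : 0 < q) (hq1 : q < 1) :
    (Submodule.span ℂ (Set.range (monomElem hq0 hq1)))ᗮ = ⊥ := by
  rw [Submodule.eq_bot_iff]
  intro F hF
  refine Subtype.ext (eq_zero_of_inner_monomVec hq0 hq1 F.2 fun n => ?_)
  exact hF _ (Submodule.subset_span ⟨n, rfl⟩)

/-- The Hilbert basis of monomials of the Arik–Coon space. -/
noncomputable def arikCoonBasis (hq0 : 0 < q) (hq1 : q < 1) :
    HilbertBasis ℕ ℂ (arikCoonSpace q) :=
  HilbertBasis.mkOfOrthogonalEqBot (orthonormal_monomElem hq0 hq1)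
    (orthogonal_span_monomElem hq0 hq1)

theorem arikCoonBasis_apply (hq0 : 0 < q) (hq1 : q < 1) (n : ℕ) :
    arikCoonBasis hq0 hq1 n = monomElem hq0 hq1 n := by
  rw [arikCoonBasis, HilbertBasis.coe_mkOfOrthogonalEqBot]

end arikCoon


/-! ### The kernel, the coherent states and the unitary transform -/

section transform

variable {q : ℝ}

/-! ### The kernel and the coherent states -/

theorem hasSum_kernelAngle (hq0 : 0 < q) (hq1 : q < 1) (z : disc q) (θ : ℝ) :
    HasSum (fun n : ℕ => ((qHermite q (Real.cos θ) n / qPoch q q n : ℝ) : ℂ) *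
      ((z : ℂ) * (√(1 - q) : ℝ)) ^ n) (kernelAngle q z θ) :=
  hasSum_qHermite hq0 hq1 (norm_mul_sqrt_lt_one hq1 z) θ

/-- Since `[n]_q! = (q; q)_n / (1 - q) ^ n`, this is the generating function with `(q; q)_n` split
into two square roots, one for each orthonormal system. -/
theorem hasSum_kernelAngle_basisFun (hq0 : 0 < q) (hq1 : q < 1) (z : disc q) {x : ℝ}
    (hx : x ∈ interval q) :
    HasSum (fun n : ℕ => (z : ℂ) ^ n / ((√(qFactorial q n) : ℝ) : ℂ) * (basisFun q n x : ℂ))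
      (kernelAngle q z (angle q x)) := by
  convert hasSum_kernelAngle hq0 hq1 z (angle q x) using 2 with n
  have h1 : qPoch q q n = √(qPoch q q n) * √(qPoch q q n) :=
    (Real.mul_self_sqrt (qPoch_self_pos hq0 hq1 n).le).symm
  have h2 : ((√(qPoch q q n) : ℝ) : ℂ) ≠ 0 := by
    exact_mod_cast (Real.sqrt_pos.2 (qPoch_self_pos hq0 hq1 n)).ne'
  have h3 : ((√(1 - q) : ℝ) : ℂ) ≠ 0 := by exact_mod_cast (sqrt_one_sub_pos hq1).ne'
  rw [cos_angle hq1 hx, basisFun, sqrt_qFactorial_eq hq0 hq1]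
  conv_rhs => rw [h1]
  rw [Complex.ofReal_mul, Complex.ofReal_div, Complex.ofReal_div, Complex.ofReal_mul,
    Complex.ofReal_inv, Complex.ofReal_pow, mul_pow]
  field_simp

theorem coherentState_eq (hq0 : 0 < q) (hq1 : q < 1) (z : disc q) {x : ℝ}
    (hx : x ∈ interval q) :
    coherentState q z x = ((√(normalization q (‖(z : ℂ)‖ ^ 2)))⁻¹ : ℝ) *
      starRingEnd ℂ (kernelAngle q z (angle q x)) := by
  rw [coherentState]
  congr 1
  have h := (hasSum_kernelAngle_basisFun hq0 hq1 z hx).star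
  refine Eq.trans (tsum_congr fun n => ?_) h.tsum_eq
  simp

theorem summable_kernel_bound (hq1 : q < 1) (z : disc q) :
    Summable fun n : ℕ =>
      (n + 1) * ((qPochInf q q)⁻¹) ^ 2 * ‖(z : ℂ) * (√(1 - q) : ℝ)‖ ^ n := by
  set t := ‖(z : ℂ) * (√(1 - q) : ℝ)‖ with ht
  have ht1 : ‖t‖ < 1 := by rw [norm_norm]; exact norm_mul_sqrt_lt_one hq1 z
  have h1 := summable_pow_mul_geometric_of_norm_lt_one 1 ht1
  have h2 := summable_geometric_of_norm_lt_one ht1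
  convert! (h1.add h2).mul_left (((qPochInf q q)⁻¹) ^ 2) using 1
  funext n
  ring

theorem exists_norm_kernelAngle_le (hq0 : 0 < q) (hq1 : q < 1) (z : disc q) :
    ∃ C : ℝ, ∀ θ, ‖kernelAngle q z θ‖ ≤ C := by
  refine ⟨_, fun θ => (hasSum_kernelAngle hq0 hq1 z θ).tsum_eq ▸
    tsum_of_norm_bounded (summable_kernel_bound hq1 z).hasSum fun n => ?_⟩
  rw [norm_mul, norm_pow, Complex.norm_real, Real.norm_eq_abs]
  exact mul_le_mul_of_nonneg_right (abs_qHermite_cos_div_le hq0 hq1 θ n) (by positivity)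

theorem measurable_kernelAngle (hq0 : 0 < q) (hq1 : q < 1) (z : disc q) :
    Measurable fun x => kernelAngle q z (angle q x) := by
  refine measurable_of_tendsto_metrizable (fun N => ?_) (tendsto_pi_nhds.2 fun x =>
    (hasSum_kernelAngle hq0 hq1 z (angle q x)).tendsto_sum_nat)
  refine Finset.measurable_sum _ fun n _ => Measurable.mul_const ?_ _
  refine (Complex.continuous_ofReal.comp ?_).measurable
  exact ((continuous_qHermite q n).comp
    (Real.continuous_cos.comp (continuous_angle q))).div_const _

theorem memLp_kernelAngle (hq0 : 0 < q) (hq1 : q < 1) (z : disc q) :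
    MemLp (fun x => kernelAngle q z (angle q x)) 2 (qGaussian q) := by
  obtain ⟨C, hC⟩ := exists_norm_kernelAngle_le hq0 hq1 z
  exact memLp_of_bound_on_interval hq0 hq1
    (measurable_kernelAngle hq0 hq1 z).aestronglyMeasurable fun x _ => hC _

theorem memLp_coherentState (hq0 : 0 < q) (hq1 : q < 1) (z : disc q) :
    MemLp (coherentState q z) 2 (qGaussian q) := by
  have h := (memLp_kernelAngle hq0 hq1 z).star.const_mul
    (((√(normalization q (‖(z : ℂ)‖ ^ 2)))⁻¹ : ℝ) : ℂ)
  refine h.ae_eq ?_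
  filter_upwards [ae_mem_interval q] with x hx
  rw [coherentState_eq hq0 hq1 z hx]
  rfl

theorem normalization_pos (hq0 : 0 < q) (hq1 : q < 1) (z : disc q) :
    0 < normalization q (‖(z : ℂ)‖ ^ 2) := by
  have ht := norm_mul_sqrt_lt_one hq1 z
  have hs : Summable fun n : ℕ => (‖(z : ℂ)‖ ^ 2) ^ n / qFactorial q n := by
    refine Summable.of_nonneg_of_le (fun n => div_nonneg (by positivity)
      (qFactorial_pos hq0 hq1 n).le) (fun n => ?_)
      ((summable_geometric_of_lt_one (sq_nonneg _)
        (pow_lt_one₀ (norm_nonneg _) ht two_ne_zero)).mul_right (qPochInf q q)⁻¹)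
    have h1 : ‖(z : ℂ) * (√(1 - q) : ℝ)‖ ^ 2 = ‖(z : ℂ)‖ ^ 2 * (1 - q) := by
      rw [norm_mul, mul_pow, Complex.norm_real, Real.norm_eq_abs, sq_abs,
        Real.sq_sqrt (sub_pos.2 hq1).le]
    rw [h1, qFactorial_eq, div_div_eq_mul_div, mul_pow, div_eq_mul_inv]
    have := sub_pos.2 hq1
    exact mul_le_mul_of_nonneg_left (inv_qPoch_self_le hq0 hq1 n) (by positivity)
  refine lt_of_lt_of_le one_pos (le_of_eq_of_le ?_ (hs.sum_le_tsum {0} fun n _ =>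
    div_nonneg (by positivity) (qFactorial_pos hq0 hq1 n).le))
  simp [qFactorial]

/-! ### The coherent state transform -/

theorem bargmannTransform_eq (hq0 : 0 < q) (hq1 : q < 1) (φ : Lp ℂ 2 (qGaussian q))
    (z : disc q) :
    bargmannTransform q φ z = ∫ x, φ x * kernelAngle q z (angle q x) ∂(qGaussian q) := by
  have hN : ((√(normalization q (‖(z : ℂ)‖ ^ 2)) : ℝ) : ℂ) ≠ 0 := by
    exact_mod_cast (Real.sqrt_pos.2 (normalization_pos hq0 hq1 z)).ne'
  rw [bargmannTransform, ← integral_const_mul]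
  refine integral_congr_ae ?_
  filter_upwards [ae_mem_interval q] with x hx
  rw [coherentState_eq hq0 hq1 z hx, map_mul, Complex.conj_conj, Complex.conj_ofReal,
    Complex.ofReal_inv]
  field_simp

theorem integrable_mul_kernelAngle (hq0 : 0 < q) (hq1 : q < 1) (φ : Lp ℂ 2 (qGaussian q))
    (z : disc q) :
    Integrable (fun x => φ x * kernelAngle q z (angle q x)) (qGaussian q) :=
  (Lp.memLp φ).integrable_mul (memLp_kernelAngle hq0 hq1 z)

theorem smul_mul_kernelAngle (φ : ℝ → ℂ) (z : ℂ) : (fun ξ : ℝ =>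
      gaussianDensity q ξ • (φ ξ * kernelAngle q z (angle q ξ))) =
    fun ξ : ℝ => kernelAngle q z (angle q ξ) * φ ξ * (gaussianDensity q ξ : ℂ) := by
  funext ξ
  rw [Complex.real_smul]
  ring

/-- The kernel is integrated term by term. The `n`-th term has `L¹` norm at most a constant times
`(n + 1) |z √(1 - q)| ^ n`, which is summable. -/
theorem hasSum_bargmannTransform (hq0 : 0 < q) (hq1 : q < 1) (φ : Lp ℂ 2 (qGaussian q))
    (z : disc q) :
    HasSum (fun n : ℕ => (z : ℂ) ^ n / ((√(qFactorial q n) : ℝ) : ℂ) *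
      inner ℂ (basisVec hq0 hq1 n) φ) (bargmannTransform q φ z) := by
  have hprob := isProbabilityMeasure_qGaussian hq0 hq1
  have hφ : Integrable φ (qGaussian q) := (Lp.memLp φ).integrable (by norm_num)
  set c : ℕ → ℂ := fun n => (z : ℂ) ^ n / ((√(qFactorial q n) : ℝ) : ℂ) with hc
  have hint : ∀ n, Integrable (fun x => c n * (φ x * (basisFun q n x : ℂ))) (qGaussian q) :=
    fun n => ((Lp.memLp φ).integrable_mul (memLp_basisFun hq0 hq1 n)).const_mul _
  have hbound : ∀ n, ∫ x, ‖c n * (φ x * (basisFun q n x : ℂ))‖ ∂(qGaussian q) ≤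
      ((n + 1) * ((qPochInf q q)⁻¹) ^ 2 * ‖(z : ℂ) * (√(1 - q) : ℝ)‖ ^ n) *
        ((qPochInf q q)⁻¹ * ∫ x, ‖φ x‖ ∂(qGaussian q)) := fun n => by
    rw [← integral_const_mul, ← integral_const_mul]
    refine integral_mono_ae (hint n).norm ((hφ.norm.const_mul _).const_mul _) ?_
    filter_upwards [ae_mem_interval q] with x hx
    rw [norm_mul, norm_mul, Complex.norm_real, Real.norm_eq_abs]
    have h1 := norm_pow_div_le hq0 hq1 (z : ℂ) n
    have h2 := abs_basisFun_le hq0 hq1 n hx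
    have h3 := inv_nonneg.2 (qPochInf_self_pos hq0 hq1).le
    calc ‖c n‖ * (‖φ x‖ * |basisFun q n x|) ≤
        (‖(z : ℂ) * (√(1 - q) : ℝ)‖ ^ n * (qPochInf q q)⁻¹) *
          (‖φ x‖ * ((n + 1) * ((qPochInf q q)⁻¹) ^ 2)) := by gcongr
      _ = _ := by ring
  have hsum : Summable fun n => ∫ x, ‖c n * (φ x * (basisFun q n x : ℂ))‖ ∂(qGaussian q) :=
    Summable.of_nonneg_of_le (fun n => integral_nonneg fun x => norm_nonneg _) hbound
      ((summable_kernel_bound hq1 z).mul_right _)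
  have h := hasSum_integral_of_summable_integral_norm hint hsum
  convert! h using 1
  · funext n
    rw [integral_const_mul, inner_basisVec]
  · rw [bargmannTransform_eq hq0 hq1]
    refine integral_congr_ae ?_
    filter_upwards [ae_mem_interval q] with x hx
    rw [← (hasSum_kernelAngle_basisFun hq0 hq1 z hx).tsum_eq, ← tsum_mul_left]
    exact tsum_congr fun n => by simp only [hc]; ring

/-- The coherent state transform as a unitary map onto the Arik–Coon space. -/
noncomputable def bargmannEquiv (hq0 : 0 < q) (hq1 : q < 1) :
    Lp ℂ 2 (qGaussian q) ≃ₗᵢ[ℂ] arikCoonSpace q :=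
  (gaussianBasis hq0 hq1).repr.trans (arikCoonBasis hq0 hq1).repr.symm

theorem inner_monomVec_bargmannEquiv (hq0 : 0 < q) (hq1 : q < 1) (φ : Lp ℂ 2 (qGaussian q))
    (n : ℕ) :
    inner ℂ (monomVec hq0 hq1 n) (bargmannEquiv hq0 hq1 φ : Lp ℂ 2 (arikCoonMeasure q)) =
      inner ℂ (basisVec hq0 hq1 n) φ := by
  have h1 := (arikCoonBasis hq0 hq1).repr_apply_apply (bargmannEquiv hq0 hq1 φ) n
  have h2 := (gaussianBasis hq0 hq1).repr_apply_apply φ n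
  rw [arikCoonBasis_apply] at h1
  rw [gaussianBasis_apply] at h2
  rw [← h2, bargmannEquiv]
  refine Eq.trans h1.symm ?_
  simp [bargmannEquiv]

/-- The abstract unitary map, defined by matching the two bases, agrees with the integral transform:
both sides are sums of the same series in `z`. -/
theorem inner_evalVec_bargmannEquiv (hq0 : 0 < q) (hq1 : q < 1) (φ : Lp ℂ 2 (qGaussian q))
    (z : disc q) :
    inner ℂ (evalVec hq0 hq1 z) (bargmannEquiv hq0 hq1 φ : Lp ℂ 2 (arikCoonMeasure q)) =
      bargmannTransform q φ z := by
  refine (hasSum_inner_evalVec hq0 hq1 z _).unique ?_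
  simp only [inner_monomVec_bargmannEquiv]
  exact hasSum_bargmannTransform hq0 hq1 φ z

end transform

end ArikCoon

open ArikCoon
theorem mainTheorem6 (q : ℝ) (hq0 : 0 < q) (hq1 : q < 1) :
    -- the coherent states belong to `L²(I_q, q-Gaussian)`
    (∀ z : disc q, MemLp (coherentState q z) 2 (qGaussian q)) ∧
    -- the elements of the Arik–Coon space are functions on `ℂ_q`
    (∀ F : arikCoonSpace q, ∃! f : disc q → ℂ, HasValues q F f) ∧
    (∀ (F G : arikCoonSpace q) (f : disc q → ℂ), HasValues q F f → HasValues q G f → F = G) ∧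
    -- the transform is a linear isometry onto the Arik–Coon space
    (∃ U : Lp ℂ 2 (qGaussian q) ≃ₗᵢ[ℂ] arikCoonSpace q,
      ∀ φ : Lp ℂ 2 (qGaussian q), HasValues q (U φ) (bargmannTransform q φ)) ∧
    -- its integral representation
    (∀ (φ : Lp ℂ 2 (qGaussian q)) (z : disc q),
      IntegrableOn (fun ξ : ℝ => kernelAngle q z (angle q ξ) * φ ξ * (gaussianDensity q ξ : ℂ))
        (interval q) ∧
      bargmannTransform q φ z =
        ∫ ξ in interval q, kernelAngle q z (angle q ξ) * φ ξ * (gaussianDensity q ξ : ℂ)) ∧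
    -- the kernel is the generating function of the continuous `q`-Hermite polynomials
    (∀ (z : disc q) (θ : ℝ),
      HasSum (fun n : ℕ => ((qHermite q (Real.cos θ) n / qPoch q q n : ℝ) : ℂ) *
        ((z : ℂ) * (√(1 - q) : ℝ)) ^ n) (kernelAngle q z θ)) := by
  refine ⟨memLp_coherentState hq0 hq1, fun F => ?_, fun F G f hF hG => ?_,
    ⟨bargmannEquiv hq0 hq1, fun φ => ?_⟩, fun φ z => ⟨?_, ?_⟩, hasSum_kernelAngle hq0 hq1⟩
  · exact ⟨_, hasValues_inner hq0 hq1 F, fun f hf => funext (hf.eq_inner hq0 hq1)⟩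
  -- If `F` and `G` share a representing function, all point evaluations of `F - G` vanish.
  · refine sub_eq_zero.1 (Subtype.ext (eq_zero_of_inner_evalVec hq0 hq1 (F - G).2 fun z => ?_))
    rw [Submodule.coe_sub, inner_sub_right, ← hF.eq_inner hq0 hq1, ← hG.eq_inner hq0 hq1, sub_self]
  · have h := hasValues_inner hq0 hq1 (bargmannEquiv hq0 hq1 φ)
    simp only [inner_evalVec_bargmannEquiv] at h
    exact h
  · rw [← smul_mul_kernelAngle]
    exact (integrable_qGaussian_iff hq0 hq1 _).1 (integrable_mul_kernelAngle hq0 hq1 φ z)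
  · rw [bargmannTransform_eq hq0 hq1, integral_qGaussian hq0 hq1, smul_mul_kernelAngle]
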